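/- Let $\mathbf H$ be a real or complex Hilbert space, $S$ its unit sphere (norm topology), $B$ its closed unit ball, and $G=U(\mathbf H)$ the group of surjective linear isometries of $\mathbf H$ with the topology $\tau_p$ of pointwise convergence on $S$ (the strong operator topology); let $\alpha$ be the natural action of $G$ on $S$. Terminology. Uniformities are ordered by inclusion (finer means larger). An equiuniformity on a $G$-space $X$ is a uniformity that induces the topology of $X$, for which every translation $x\mapsto gx$ is uniformly continuous, and such that for every uniform cover $u$ there are a neighbourhood $O$ of the unit $e\in G$ and a uniform cover $v$ for which $\{OV: V\in v\}$ refines $u$. For a totally bounded equiuniformity $\mathcal U$ on $X$ let $bX$ be the completion of $(X,\mathcal U)$, with its uniformity $\tilde{\mathcal U}$ and the extended action of $G$. Then $\mathfrak E_\alpha(\mathcal U)$ is the uniformity that $G$ inherits through $g\mapsto(x\mapsto gx)$ from the product uniformity on $X^X$, and $\tilde{\mathfrak E}_\alpha(\mathcal U)$ is the one that it inherits in the same way from $(bX)^{bX}$. $L$, $R$ are the left and right uniformities of $G$, $L\wedge R$ (the Roelcke uniformity) is their greatest lower bound, $G$ is Roelcke precompact if $L\wedge R$ is totally bounded, and $b_rG$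 is the completion of $(G,L\wedge R)$. For a set $Y$ on which $G$ acts, $R_{\Sigma_Y}$ is the uniformity on $G$ with base the covers $\{Og\,\mathrm{St}_\sigma: g\in G\}$, where $O$ runs over the neighbourhoods of $e$ and $\mathrm{St}_\sigma$ over the pointwise stabilizers of the finite sets $\sigma\subset Y$. A proper enveloping Ellis semigroup compactification of $G$ is a compact Hausdorff semigroup $K$ in which every right multiplication $x\mapsto xy$ is continuous, with a homomorphism $s:G\to K$ that is a topological embedding with dense image, such that the multiplication is continuous on $s(G)\times K$. An Ellis equiuniformity on $G$ is a totally bounded equiuniformity for the action of $G$ on itself by left multiplication whose completion is, for some multiplication, a proper enveloping Ellis semigroup compactification of $G$. Theorem. There is a largest equiuniformity $\mathcal U_S$ on $S$, it is totally bounded, and: (a) $\tilde{\mathfrak E}_\alpha(\mathcal U_S)=\mathfrak E_\alpha(\mathcal U_S)=L\wedge R=R_{\Sigma_S}=R_{\Sigma_B}$. Hence $(U(\mathbf H),\tau_p)$ is Roelcke precompact, $L\wedge R$ is an Ellis equiuniformity, and $b_rU(\mathbf H)$, with the canonical map $U(\mathbf H)\to b_rU(\mathbf H)$ and a suitable multiplication,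 is a proper enveloping Ellis semigroup compactification of $U(\mathbf H)$. (b) If $\mathbf H$ is infinite-dimensional, then $b_rU(\mathbf H)$ with this multiplication is isomorphic, by an isomorphism of semigroups that is a homeomorphism and sends the image of each $g\in U(\mathbf H)$ to the operator $g$, to the semigroup under composition of all linear operators on $\mathbf H$ of norm $\le 1$ in the weak operator topology. (c) With this multiplication $b_rU(\mathbf H)$ is a semitopological semigroup: its multiplication is separately continuous. -/

import Mathlib

open Set Filter Topology UniformSpace

noncomputable section

/-! ### Uniformities attached to a group action

Mathlib orders uniformities by inclusion of entourage filters, so that a *smaller* element is a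
*finer* uniformity: the supremum `⊔` of Mathlib is the greatest lower bound `∧` of the usual order
of uniformities, and the finest uniformity of a family is its `sInf`. -/

/-- The topology of pointwise convergence on a group acting on a topological space `X`: it has
the subbase of all sets `{g | g • x ∈ O}` with `x ∈ X` and `O ⊆ X` open. -/
@[reducible]
def pointwiseTopology (G X : Type*) [SMul G X] [TopologicalSpace X] : TopologicalSpace G :=
  TopologicalSpace.induced (fun (g : G) (x : X) => g • x) inferInstance

/-- An equiuniformity on a `G`-space `X`: a uniformity `u` compatible with the topology of `X`
which is saturated (every translation is uniformly continuous) and bounded (for every uniform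
cover there are a neighbourhood `O` of the unit and a uniform cover `v` such that
`{O • V | V ∈ v}` refines the given cover; it is enough to take uniform covers of the form
`{U[y] | y ∈ X}` with `U` an entourage). -/
structure IsEquiuniformity (G : Type*) {X : Type*} [Group G] [TopologicalSpace G]
    [MulAction G X] [tX : TopologicalSpace X] (u : UniformSpace X) : Prop where
  compatible : u.toTopologicalSpace = tX
  saturated : ∀ g : G, @UniformContinuous X X u u (fun x => g • x)
  bounded : ∀ U ∈ @uniformity X u, ∃ O ∈ 𝓝 (1 : G), ∃ V ∈ @uniformity X u,
    ∀ x : X, ∃ y : X, ∀ g ∈ O, ∀ z : X, (x, z) ∈ V → (y, g • z) ∈ U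

/-- The uniformity `u` on `X` is totally bounded. -/
def IsTotallyBoundedUniformity {X : Type*} (u : UniformSpace X) : Prop :=
  @TotallyBounded X u Set.univ

/-- The maximal equiuniformity on a `G`-space: the least upper bound (in the order in which finer
uniformities are larger) of all equiuniformities. It is itself an equiuniformity as soon as there
is at least one. -/
@[reducible]
def maxEquiuniformity (G X : Type*) [Group G] [TopologicalSpace G] [MulAction G X]
    [TopologicalSpace X] : UniformSpace X :=
  sInf {u : UniformSpace X | IsEquiuniformity G u}

/-- `𝔈_α(u)`: the restriction to `G`, viewed inside `X ^ X` through the action, of the uniformity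
of pointwise convergence `u ^ p`. -/
@[reducible]
def ellisUniformity (G : Type*) {X : Type*} [SMul G X] (u : UniformSpace X) : UniformSpace G :=
  UniformSpace.comap (fun (g : G) (x : X) => g • x)
    (@Pi.uniformSpace X (fun _ => X) (fun _ => u))

/-- The underlying set of the completion of the uniform space `(X, u)`. -/
abbrev CompletionOf {X : Type*} (u : UniformSpace X) : Type _ := @Completion X u

/-- `𝔈̃_α(u)`: the restriction to `G` of the uniformity of pointwise convergence on `bX ^ bX`,
where `bX` is the completion of `(X, u)` and `g : G` acts on `bX` by the continuous extension of
`x ↦ g • x` (meaningful when all translations are uniformly continuous for `u`). -/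
@[reducible]
def extendedEllisUniformity (G : Type*) {X : Type*} [SMul G X] (u : UniformSpace X) :
    UniformSpace G :=
  UniformSpace.comap
    (fun (g : G) (y : CompletionOf u) => @Completion.map X u X u (fun x => g • x) y)
    inferInstance

/-- The Roelcke uniformity `L ∧ R` of a topological group. -/
@[reducible]
def roelckeUniformity (G : Type*) [Group G] [TopologicalSpace G] [IsTopologicalGroup G] :
    UniformSpace G :=
  IsTopologicalGroup.leftUniformSpace G ⊔ IsTopologicalGroup.rightUniformSpace G

/-- The entourage of pairs `(a, b)` with `b ∈ O a St_σ`, where `St_σ` is the pointwise stabilizer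
of the finite set `σ`. -/
def stabilizerEntourage {G X : Type*} [Group G] [MulAction G X] (O : Set G) (σ : Finset X) :
    Set (G × G) :=
  {p | ∃ h ∈ O, ∃ s ∈ fixingSubgroup G (σ : Set X), p.2 = h * p.1 * s}

/-- The uniformity `R_{Σ_X}` on a topological group acting on a set `X`, given by the family of
the pointwise stabilizers `St_σ` of the finite subsets `σ` of `X`: its uniform covers are
generated by the covers `{O g St_σ | g ∈ G}`, with `O` a neighbourhood of the unit. -/
@[reducible]
def stabilizerUniformity (G X : Type*) [Group G] [TopologicalSpace G] [IsTopologicalGroup G]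
    [MulAction G X] : UniformSpace G :=
  UniformSpace.ofCore <| UniformSpace.Core.mkOfBasis
    { sets := {E | ∃ O ∈ 𝓝 (1 : G), ∃ σ : Finset X, E = stabilizerEntourage O σ}
      nonempty := ⟨_, Set.univ, univ_mem, ∅, rfl⟩
      inter_sets := by
        classical
        rintro _ _ ⟨O, hO, σ, rfl⟩ ⟨O', hO', σ', rfl⟩
        refine ⟨_, ⟨O ∩ O', inter_mem hO hO', σ ∪ σ', rfl⟩, ?_⟩
        rintro p ⟨h, hh, s, hs, e⟩
        simp only [mem_fixingSubgroup_iff, Finset.coe_union, Set.mem_union] at hs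
        exact ⟨⟨h, hh.1, s, (mem_fixingSubgroup_iff G).2 fun x hx => hs x (Or.inl hx), e⟩,
          ⟨h, hh.2, s, (mem_fixingSubgroup_iff G).2 fun x hx => hs x (Or.inr hx), e⟩⟩ }
    (by
      rintro _ ⟨O, hO, σ, rfl⟩ x
      exact ⟨1, mem_of_mem_nhds hO, 1, one_mem _, by simp⟩)
    (by
      rintro _ ⟨O, hO, σ, rfl⟩
      refine ⟨_, ⟨O⁻¹, inv_mem_nhds_one G hO, σ, rfl⟩, ?_⟩
      rintro p ⟨h, hh, s, hs, e⟩
      exact ⟨h⁻¹, hh, s⁻¹, inv_mem hs, by simp [e, mul_assoc]⟩)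
    (by
      rintro _ ⟨O, hO, σ, rfl⟩
      obtain ⟨V, hV, hVO⟩ := exists_nhds_one_split hO
      refine ⟨_, ⟨V, hV, σ, rfl⟩, ?_⟩
      rintro ⟨a, c⟩ ⟨b, ⟨h, hh, s, hs, e⟩, ⟨h', hh', s', hs', e'⟩⟩
      refine ⟨h' * h, hVO _ hh' _ hh, s * s', mul_mem hs hs', ?_⟩
      simp only at e e' ⊢
      rw [e', e]
      simp only [mul_assoc])

/-! ### Proper enveloping Ellis semigroup compactifications -/

/-- `(S, s)` is a proper enveloping Ellis semigroup compactification of the topological group `G`: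
`S` is a compact Hausdorff right topological semigroup, `s` is a homomorphism and a topological
embedding onto a dense subset, and the multiplication is continuous on `s(G) × S`. -/
structure IsProperEllisCompactification (G S : Type*) [Group G] [TopologicalSpace G]
    [Semigroup S] [TopologicalSpace S] (s : G → S) : Prop where
  compact : CompactSpace S
  hausdorff : T2Space S
  right_topological : ∀ y : S, Continuous fun x : S => x * y
  map_mul : ∀ g h : G, s (g * h) = s g * s h
  embedding : IsEmbedding s
  dense : DenseRange s
  continuous_mul : Continuous fun p : Set.range s × S => (p.1 : S) * p.2

/-- The canonical map of `X` to the completion of `(X, u)`. -/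
def toCompletionOf {X : Type*} (u : UniformSpace X) (x : X) : CompletionOf u :=
  @Completion.coe' X u x

/-- An Ellis equiuniformity on a topological group `G`: a totally bounded equiuniformity `u` for
the action of `G` on itself by left multiplication, such that the completion of `(G, u)` is
(for some multiplication) a proper enveloping Ellis semigroup compactification of `G`. -/
structure IsEllisEquiuniformity (G : Type*) [Group G] [TopologicalSpace G]
    (u : UniformSpace G) : Prop where
  equiuniformity : IsEquiuniformity G u
  totallyBounded : IsTotallyBoundedUniformity u
  ellis : ∃ _ : Semigroup (CompletionOf u),
    IsProperEllisCompactification G (CompletionOf u) (toCompletionOf u)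

/-- A topological group is Roelcke precompact if its Roelcke uniformity is totally bounded. -/
def IsRoelckePrecompact (G : Type*) [Group G] [TopologicalSpace G] [IsTopologicalGroup G] : Prop :=
  IsTotallyBoundedUniformity (roelckeUniformity G)

/-- The completion `b_r G` of a topological group with respect to its Roelcke uniformity. -/
abbrev RoelckeCompletion (G : Type*) [Group G] [TopologicalSpace G] [IsTopologicalGroup G] :
    Type _ :=
  CompletionOf (roelckeUniformity G)

/-- The canonical map `G → b_r G`. -/
def toRoelckeCompletion (G : Type*) [Group G] [TopologicalSpace G] [IsTopologicalGroup G] :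
    G → RoelckeCompletion G :=
  toCompletionOf (roelckeUniformity G)

/-! ### The unitary group of a Hilbert space -/

section Unitary

variable (𝕜 H : Type*) [RCLike 𝕜] [NormedAddCommGroup H] [InnerProductSpace 𝕜 H]

/-- The unit sphere of `H`, with the norm topology. -/
abbrev UnitSphere (H : Type*) [NormedAddCommGroup H] : Type _ := Metric.sphere (0 : H) 1

/-- The closed unit ball of `H`. -/
abbrev UnitBall (H : Type*) [NormedAddCommGroup H] : Type _ := Metric.closedBall (0 : H) 1

/-- The unitary (orthogonal, if the scalars are real) group of `H`: the group of surjective linear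
isometries, under composition. -/
abbrev UnitaryGroup : Type _ := H ≃ₗᵢ[𝕜] H

instance unitaryActionSphere : MulAction (UnitaryGroup 𝕜 H) (UnitSphere H) where
  smul g x := ⟨g x, by simp⟩
  one_smul _ := rfl
  mul_smul _ _ _ := rfl

instance unitaryActionBall : MulAction (UnitaryGroup 𝕜 H) (UnitBall H) where
  smul g x := ⟨g x, by simpa using mem_closedBall_zero_iff.1 x.2⟩
  one_smul _ := rfl
  mul_smul _ _ _ := rfl

/-- The unitary group carries the topology of pointwise convergence for its action on the unit
sphere (that is, the strong operator topology). -/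
instance unitaryTopology : TopologicalSpace (UnitaryGroup 𝕜 H) :=
  pointwiseTopology (UnitaryGroup 𝕜 H) (UnitSphere H)

variable {𝕜 H} in
theorem unitary_tendsto_iff {ι : Type*} {l : Filter ι} {f : ι → UnitaryGroup 𝕜 H}
    {g : UnitaryGroup 𝕜 H} :
    Tendsto f l (𝓝 g) ↔ ∀ x : H, Tendsto (fun i => f i x) l (𝓝 (g x)) := by
  rw [nhds_induced, tendsto_comap_iff, tendsto_pi_nhds]
  constructor
  · intro h x
    rcases eq_or_ne x 0 with rfl | hx
    · simpa using tendsto_const_nhds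
    · have hn : ‖x‖ ≠ 0 := norm_ne_zero_iff.2 hx
      have h1 := h ⟨(‖x‖⁻¹ : 𝕜) • x, by simp [norm_smul, hn]⟩
      have h2 := (tendsto_subtype_rng.1 h1).const_smul (‖x‖ : 𝕜)
      have e : ∀ k : UnitaryGroup 𝕜 H, (‖x‖ : 𝕜) • k ((‖x‖⁻¹ : 𝕜) • x) = k x := fun k => by
        rw [map_smul, smul_smul, mul_inv_cancel₀ (by exact_mod_cast hn), one_smul]
      have h3 : Tendsto (fun i => (‖x‖ : 𝕜) • f i ((‖x‖⁻¹ : 𝕜) • x)) l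
          (𝓝 ((‖x‖ : 𝕜) • g ((‖x‖⁻¹ : 𝕜) • x))) := h2
      simpa only [e] using h3
  · intro h x
    exact tendsto_subtype_rng.2 (h x)

instance unitaryTopologicalGroup : IsTopologicalGroup (UnitaryGroup 𝕜 H) where
  continuous_mul := by
    refine continuous_iff_continuousAt.2 fun p => unitary_tendsto_iff.2 fun x => ?_
    have h1 := unitary_tendsto_iff.1 (continuous_fst.tendsto p) (p.2 x)
    have h2 := unitary_tendsto_iff.1 (continuous_snd.tendsto p) x
    rw [tendsto_iff_dist_tendsto_zero] at h1 h2 ⊢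
    refine squeeze_zero (fun _ => dist_nonneg) (fun q => ?_) (by simpa using h2.add h1)
    calc dist (q.1 (q.2 x)) (p.1 (p.2 x))
        ≤ dist (q.1 (q.2 x)) (q.1 (p.2 x)) + dist (q.1 (p.2 x)) (p.1 (p.2 x)) :=
          dist_triangle _ _ _
      _ = dist (q.2 x) (p.2 x) + dist (q.1 (p.2 x)) (p.1 (p.2 x)) := by
          rw [q.1.isometry.dist_eq]
  continuous_inv := by
    refine continuous_iff_continuousAt.2 fun g => unitary_tendsto_iff.2 fun x => ?_
    have h := unitary_tendsto_iff.1 (continuous_id.tendsto g) (g⁻¹ x)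
    rw [tendsto_iff_dist_tendsto_zero] at h ⊢
    refine h.congr fun k => ?_
    have e : g (g⁻¹ x) = x := g.apply_symm_apply x
    have e' : k (k⁻¹ x) = x := k.apply_symm_apply x
    calc dist (k (g⁻¹ x)) (g (g⁻¹ x)) = dist (k (g⁻¹ x)) (k (k⁻¹ x)) := by rw [e, e']
      _ = dist (k⁻¹ x) (g⁻¹ x) := by rw [k.isometry.dist_eq, dist_comm]

instance unitaryContinuousSMulSphere :
    ContinuousSMul (UnitaryGroup 𝕜 H) (UnitSphere H) where
  continuous_smul := by
    refine continuous_iff_continuousAt.2 fun p => tendsto_subtype_rng.2 ?_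
    have h1 := unitary_tendsto_iff.1 (continuous_fst.tendsto p) (p.2 : H)
    have h2 : Tendsto (fun q : UnitaryGroup 𝕜 H × UnitSphere H => (q.2 : H)) (𝓝 p) (𝓝 p.2) :=
      (continuous_subtype_val.comp continuous_snd).tendsto p
    rw [tendsto_iff_dist_tendsto_zero] at h1 h2 ⊢
    refine squeeze_zero (fun _ => dist_nonneg) (fun q => ?_) (by simpa using h2.add h1)
    calc dist (q.1 (q.2 : H)) (p.1 (p.2 : H))
        ≤ dist (q.1 (q.2 : H)) (q.1 (p.2 : H)) + dist (q.1 (p.2 : H)) (p.1 (p.2 : H)) :=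
          dist_triangle _ _ _
      _ = dist (q.2 : H) (p.2 : H) + dist (q.1 (p.2 : H)) (p.1 (p.2 : H)) := by
          rw [q.1.isometry.dist_eq]

/-- The semigroup (under composition) of all bounded linear operators on `H` of norm at most `1`;
as a subtype of `H →WOT[𝕜] H` it carries the weak operator topology. -/
def contractions : Submonoid (H →WOT[𝕜] H) where
  carrier := {T | ‖T.toCLM‖ ≤ 1}
  one_mem' := ContinuousLinearMap.norm_id_le
  mul_mem' {S T} hS hT :=
    (ContinuousLinearMap.opNorm_comp_le S.toCLM T.toCLM).trans
      (mul_le_one₀ hS (norm_nonneg _) hT)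

end Unitary

end

/-!
The unitary group `G` carries the uniformity `W` of the matrix coefficients `g ↦ ⟪v, g x⟫`, which
it inherits from the weak operator topology, and every object of the theorem is computed from `W`.

In Mathlib's order (smaller is finer), `L ⊔ R ≤ W ≤ R_Σ ≤ L ⊔ R`, so these uniformities are equal.
The outer inequalities are direct. The middle one says that two unitaries `a`, `b` whose matrix
coefficients are close on `E × F`, for finite-dimensional `E` and `F`, satisfy `b = h a` on `E` for
some unitary `h` which is close to the identity on `F`. If the space is finite-dimensional, one
takes `F` to be all of it and `h = b a⁻¹`. In infinite dimension (`exists_unitary_near_one`) such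
an `h` is obtained by an amalgamation: for a fixed isometry `V : F → Eᗮ` there is a
unitary `h_a` with `h_a a e = e` and `h_a f = T_a f + V D_a f`, where `T_a = P_E a⁻¹|_F` and
`D_a = (1 - T_a⋆ T_a) ^ (1 / 2)` (`exists_unitary_normal_form`), because both systems of vectors
have the same Gram matrix. Then `h = h_b⁻¹ h_a` has the required property, since positive square
roots depend continuously on the operator (`LinearMap.IsPositive.norm_sub_sq_le`).

The same lemma for a one-dimensional `E` shows that weakly close points of the sphere lie in one
small orbit piece `O x`, and therefore the weak uniformity, which is a totally bounded
equiuniformity, is the largest one (`maxEquiuniformity_sphere_eq`); a finite-dimensional sphere is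
compact and has only one uniformity. The Ellis uniformity of the weak uniformity is `W`, as both
are given by the functions `g ↦ ⟪v, g x⟫`; passing to the completion adds nothing, because by the
Fréchet–Riesz theorem the points of the completed sphere are vectors of the ball
(`operatorWeakUniformity_le_extendedEllisUniformity`).

Finally, the contractions form a compact semitopological semigroup in the weak operator topology,
so the completion of `(G, W)` is the closure of `G` there, with the multiplication of operators
(`exists_semigroup_completion`). In infinite dimension this closure consists of all contractions,
because a compression of a contraction to a finite-dimensional subspace has a unitary dilation
(`exists_unitary_dilation`).
-/

open scoped InnerProductSpace Uniformity
open RCLike (re)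

/-! ### Unitaries with prescribed values on finite-dimensional subspaces -/

section LinearAlgebra

variable {𝕜 H : Type*} [RCLike 𝕜] [NormedAddCommGroup H] [InnerProductSpace 𝕜 H]

/-- An isometry of a finite-dimensional subspace is extended by the identity on the orthogonal
complement. -/
theorem exists_unitary_extending (N : Submodule 𝕜 H) [FiniteDimensional 𝕜 N] (L : N ≃ₗᵢ[𝕜] N) :
    ∃ h : H ≃ₗᵢ[𝕜] H, ∀ x : N, h x = L x := by
  set P := N.orthogonalProjectionOnto
  have hP : ∀ x : H, x - P x ∈ Nᗮ := fun x => N.sub_starProjection_mem_orthogonal x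
  have hPN : ∀ x : N, P x = x := fun x => N.orthogonalProjectionOnto_mem_subspace_eq_self x
  have hP0 : ∀ x ∈ Nᗮ, P x = 0 := fun x hx =>
    Submodule.orthogonalProjectionOnto_apply_of_mem_orthogonal hx
  have key : ∀ (u : N) (w : H), w ∈ Nᗮ → ‖(u : H) + w‖ * ‖(u : H) + w‖ = ‖u‖ * ‖u‖ + ‖w‖ * ‖w‖ :=
    fun u w hw => norm_add_sq_eq_norm_sq_add_norm_sq_of_inner_eq_zero _ _ (hw u u.2)
  let f₀ : H →ₗ[𝕜] H := N.subtype ∘ₗ L.toLinearEquiv.toLinearMap ∘ₗ (P : H →ₗ[𝕜] N) +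
    (LinearMap.id - N.subtype ∘ₗ (P : H →ₗ[𝕜] N))
  have hf₀ : ∀ x, f₀ x = (L (P x) : H) + (x - P x) := fun x => rfl
  let f : H →ₗᵢ[𝕜] H :=
    { toLinearMap := f₀
      norm_map' := fun x => by
        rw [hf₀, ← mul_self_inj (norm_nonneg _) (norm_nonneg _), key _ _ (hP x), L.norm_map,
          ← key _ _ (hP x), add_sub_cancel] }
  have hf : ∀ x, f x = (L (P x) : H) + (x - P x) := fun x => rfl
  have hsurj : Function.Surjective f := fun y => by
    refine ⟨L.symm (P y) + (y - P y), ?_⟩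
    rw [hf, map_add, hPN, hP0 _ (hP y)]
    simp
  refine ⟨LinearIsometryEquiv.ofSurjective f hsurj, fun x => ?_⟩
  rw [LinearIsometryEquiv.coe_ofSurjective, hf, hPN]
  simp

/-- Two linear maps out of a finite-dimensional space which induce the same seminorm there (that
is, two systems of vectors with the same Gram matrix) differ by a unitary operator. -/
theorem exists_unitary_comp_eq {M : Type*} [AddCommGroup M] [Module 𝕜 M] [FiniteDimensional 𝕜 M]
    (p q : M →ₗ[𝕜] H) (hpq : ∀ m, ‖p m‖ = ‖q m‖) : ∃ h : H ≃ₗᵢ[𝕜] H, ∀ m, h (p m) = q m := by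
  set N : Submodule 𝕜 H := p.range ⊔ q.range
  let p' : M →ₗ[𝕜] N := p.codRestrict N fun m => le_sup_left (a := p.range) ⟨m, rfl⟩
  let q' : M →ₗ[𝕜] N := q.codRestrict N fun m => le_sup_right (a := p.range) ⟨m, rfl⟩
  have hpq' : ∀ m, ‖p' m‖ = ‖q' m‖ := hpq
  obtain ⟨g, hg⟩ := p'.rangeRestrict.exists_rightInverse_of_surjective p'.range_rangeRestrict
  have hg' : ∀ s : p'.range, p' (g s) = s := fun s =>
    congrArg Subtype.val (LinearMap.congr_fun hg s)
  let L : p'.range →ₗᵢ[𝕜] N :=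
    { toLinearMap := q' ∘ₗ g
      norm_map' := fun s => by
        rw [LinearMap.comp_apply, ← hpq', hg', Submodule.norm_coe] }
  obtain ⟨h, hh⟩ := exists_unitary_extending N (L.extend.toLinearIsometryEquiv rfl)
  refine ⟨h, fun m => ?_⟩
  have h1 : L.extend (p' m) = L ⟨p' m, m, rfl⟩ := L.extend_apply ⟨p' m, m, rfl⟩
  have h2 : L ⟨p' m, m, rfl⟩ = q' m := by
    have : q' (g ⟨p' m, m, rfl⟩ - m) = 0 := by
      rw [← norm_eq_zero, ← hpq', map_sub, hg', sub_self, norm_zero]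
    rwa [map_sub, sub_eq_zero] at this
  have h3 := hh (p' m)
  rw [LinearIsometry.coe_toLinearIsometryEquiv, h1, h2] at h3
  exact h3

/-- In an infinite-dimensional space, every finite-dimensional inner product space embeds
isometrically into the orthogonal complement of a given finite-dimensional subspace. -/
theorem exists_isometry_into_orthogonal (hH : ¬ FiniteDimensional 𝕜 H) (E : Submodule 𝕜 H)
    [FiniteDimensional 𝕜 E] (F : Type*) [NormedAddCommGroup F] [InnerProductSpace 𝕜 F]
    [FiniteDimensional 𝕜 F] : ∃ V : F →ₗᵢ[𝕜] H, ∀ x, V x ∈ Eᗮ := by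
  have hE : ¬ FiniteDimensional 𝕜 Eᗮ := fun h => hH <| by
    have : E ⊔ Eᗮ = ⊤ := Submodule.sup_orthogonal_of_hasOrthogonalProjection
    have h2 : FiniteDimensional 𝕜 (E ⊔ Eᗮ : Submodule 𝕜 H) := inferInstance
    rw [this] at h2
    exact Module.Finite.equiv (Submodule.topEquiv (R := 𝕜) (M := H))
  have hr : ((Module.finrank 𝕜 F : ℕ) : Cardinal) ≤ Module.rank 𝕜 Eᗮ := by
    refine le_trans (Cardinal.natCast_lt_aleph0).le (not_lt.1 fun h => hE ?_)
    exact Module.rank_lt_aleph0_iff.1 h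
  obtain ⟨f, hf⟩ := exists_linearIndependent_of_le_rank hr
  have hfr := finrank_span_eq_card hf
  rw [Fintype.card_fin] at hfr
  set K := Submodule.span 𝕜 (Set.range f)
  have : FiniteDimensional 𝕜 K := FiniteDimensional.span_of_finite 𝕜 (Set.finite_range f)
  let e : F ≃ₗᵢ[𝕜] K :=
    (stdOrthonormalBasis 𝕜 F).equiv (stdOrthonormalBasis 𝕜 K) (finCongr hfr.symm)
  exact ⟨Eᗮ.subtypeₗᵢ.comp (K.subtypeₗᵢ.comp e.toLinearIsometry), fun x => Subtype.property _⟩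

/-- Positive operators on a finite-dimensional space have positive square roots. -/
theorem LinearMap.IsPositive.exists_sqrt {F : Type*} [NormedAddCommGroup F]
    [InnerProductSpace 𝕜 F] [FiniteDimensional 𝕜 F] {A : F →ₗ[𝕜] F} (hA : A.IsPositive) :
    ∃ D : F →ₗ[𝕜] F, D.IsPositive ∧ ∀ x, ‖D x‖ ^ 2 = re ⟪A x, x⟫_𝕜 := by
  have hn : Module.finrank 𝕜 F = Module.finrank 𝕜 F := rfl
  set b := hA.isSymmetric.eigenvectorBasis hn
  set l := hA.isSymmetric.eigenvalues hn
  have hl : ∀ i, 0 ≤ l i := fun i => hA.nonneg_eigenvalues hn i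
  let D : F →ₗ[𝕜] F := ∑ i, ((√(l i) : ℝ) : 𝕜) •
    (InnerProductSpace.rankOne 𝕜 (b i) (b i) : F →L[𝕜] F).toLinearMap
  have hD : D.IsPositive := LinearMap.isPositive_sum _ fun i _ =>
    (InnerProductSpace.isPositive_rankOne_self (b i)).toLinearMap.smul_of_nonneg
      (RCLike.ofReal_nonneg.2 (Real.sqrt_nonneg _))
  have hDb : ∀ i, D (b i) = ((√(l i) : ℝ) : 𝕜) • b i := fun i => by
    simp [D, LinearMap.sum_apply, InnerProductSpace.rankOne_apply,
      orthonormal_iff_ite.1 b.orthonormal]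
  have hDD : ∀ x, D (D x) = A x := by
    refine LinearMap.congr_fun (f := D ∘ₗ D) (b.toBasis.ext fun i => ?_)
    rw [b.coe_toBasis, LinearMap.comp_apply, hDb, map_smul, hDb, smul_smul, ← RCLike.ofReal_mul,
      Real.mul_self_sqrt (hl i)]
    exact (hA.isSymmetric.apply_eigenvectorBasis hn i).symm
  refine ⟨D, hD, fun x => ?_⟩
  rw [← hDD, hD.isSymmetric, inner_self_eq_norm_sq_to_K]
  norm_cast

/-- Square roots of positive operators depend continuously on the operators: an eigenvector `v`
of `D - D'` for an eigenvalue `c` satisfies `|c| ^ 2 * ‖v‖ ^ 2 ≤ |‖D v‖ ^ 2 - ‖D' v‖ ^ 2|`. -/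
theorem LinearMap.IsPositive.norm_sub_sq_le {F : Type*} [NormedAddCommGroup F]
    [InnerProductSpace 𝕜 F] [FiniteDimensional 𝕜 F] {D D' : F →ₗ[𝕜] F} (hD : D.IsPositive)
    (hD' : D'.IsPositive) {η : ℝ} (h : ∀ x, |‖D x‖ ^ 2 - ‖D' x‖ ^ 2| ≤ η * ‖x‖ ^ 2) (x : F) :
    ‖D x - D' x‖ ^ 2 ≤ η * ‖x‖ ^ 2 := by
  have hs : (D - D').IsSymmetric := hD.isSymmetric.sub hD'.isSymmetric
  have hn : Module.finrank 𝕜 F = Module.finrank 𝕜 F := rfl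
  set b := hs.eigenvectorBasis hn with hb
  set l := hs.eigenvalues hn with hl
  have hev : ∀ i, D (b i) = D' (b i) + (l i : 𝕜) • b i := fun i => by
    have := hs.apply_eigenvectorBasis hn i
    rw [LinearMap.sub_apply] at this
    exact sub_eq_iff_eq_add'.1 this
  have hb1 : ∀ i, ‖b i‖ = 1 := fun i => b.orthonormal.1 i
  have hle : ∀ i, l i ^ 2 ≤ η := by
    intro i
    have h0 := h (b i)
    rw [hb1, one_pow, mul_one] at h0
    have h1 : re ⟪D (b i), b i⟫_𝕜 = re ⟪D' (b i), b i⟫_𝕜 + l i := by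
      rw [hev, inner_add_left, inner_smul_left, inner_self_eq_norm_sq_to_K, hb1]
      simp
    have h2 : ‖D (b i)‖ ^ 2 = ‖D' (b i)‖ ^ 2 + 2 * (l i * re ⟪D' (b i), b i⟫_𝕜) + l i ^ 2 := by
      rw [hev, norm_add_sq (𝕜 := 𝕜), inner_smul_right, RCLike.re_ofReal_mul, norm_smul, hb1]
      simp
    have h3 : 0 ≤ re ⟪D (b i), b i⟫_𝕜 := hD.re_inner_nonneg_left _
    have h4 : 0 ≤ re ⟪D' (b i), b i⟫_𝕜 := hD'.re_inner_nonneg_left _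
    -- `‖D (b i)‖ ^ 2 - ‖D' (b i)‖ ^ 2` is `≥ l i ^ 2` if `0 ≤ l i` and `≤ -(l i ^ 2)` otherwise
    rcases le_total 0 (l i) with hli | hli
    · have := mul_nonneg hli h4
      nlinarith [(abs_le.1 h0).2]
    · have := mul_nonneg (neg_nonneg.2 hli) h3
      rw [h1] at this
      nlinarith [(abs_le.1 h0).1]
  have hx : ∀ i, ⟪b i, D x - D' x⟫_𝕜 = l i * ⟪b i, x⟫_𝕜 := fun i => by
    have := hs (b i) x
    rw [LinearMap.sub_apply, LinearMap.sub_apply, hev, add_sub_cancel_left, inner_smul_left] at this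
    simpa using this.symm
  rw [← b.sum_sq_norm_inner_right, ← b.sum_sq_norm_inner_right x, Finset.mul_sum]
  refine Finset.sum_le_sum fun i _ => ?_
  rw [hx, norm_mul, mul_pow, RCLike.norm_ofReal, sq_abs]
  gcongr
  exact hle i

end LinearAlgebra

/-! ### Unitaries close to the identity and unitary dilations -/

section Amalgamation

variable {𝕜 H : Type*} [RCLike 𝕜] [NormedAddCommGroup H] [InnerProductSpace 𝕜 H]

/-- The defect operator `(1 - T⋆ T) ^ (1 / 2)` of a contraction `T` between finite-dimensional
spaces. -/
theorem exists_defect {E F : Type*} [NormedAddCommGroup E] [InnerProductSpace 𝕜 E]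
    [FiniteDimensional 𝕜 E] [NormedAddCommGroup F] [InnerProductSpace 𝕜 F]
    [FiniteDimensional 𝕜 F] (T : F →ₗ[𝕜] E) (hT : ∀ x, ‖T x‖ ≤ ‖x‖) :
    ∃ D : F →ₗ[𝕜] F, D.IsPositive ∧ ∀ x, ‖D x‖ ^ 2 = ‖x‖ ^ 2 - ‖T x‖ ^ 2 := by
  let A : F →ₗ[𝕜] F := LinearMap.id - LinearMap.adjoint T ∘ₗ T
  have hA : ∀ x, re ⟪A x, x⟫_𝕜 = ‖x‖ ^ 2 - ‖T x‖ ^ 2 := fun x => by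
    simp only [A, LinearMap.sub_apply, LinearMap.id_apply, LinearMap.comp_apply, inner_sub_left,
      LinearMap.adjoint_inner_left, map_sub, inner_self_eq_norm_sq]
  have hpos : A.IsPositive := by
    refine ⟨fun x y => ?_, fun x => ?_⟩
    · simp only [A, LinearMap.sub_apply, LinearMap.id_apply, LinearMap.comp_apply, inner_sub_left,
        LinearMap.adjoint_inner_left, inner_sub_right, LinearMap.adjoint_inner_right]
    · rw [hA]
      exact sub_nonneg.2 (pow_le_pow_left₀ (norm_nonneg _) (hT x) 2)
  obtain ⟨D, hD, h⟩ := hpos.exists_sqrt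
  exact ⟨D, hD, fun x => by rw [h, hA]⟩

/-- Every pair `(a|_E, F)` with `a` unitary can be moved by a unitary to a normal form, which
depends only on the compression `P_E a⁻¹|_F` and its defect operator: `a e` goes to `e` and `f` to
`P_E a⁻¹ f + V D f`. -/
theorem exists_unitary_normal_form (E F : Submodule 𝕜 H) [FiniteDimensional 𝕜 E]
    [FiniteDimensional 𝕜 F] (V : F →ₗᵢ[𝕜] H) (hV : ∀ x, V x ∈ Eᗮ) (a : H ≃ₗᵢ[𝕜] H)
    (D : F →ₗ[𝕜] F)
    (hD : ∀ f : F, ‖D f‖ ^ 2 = ‖f‖ ^ 2 - ‖E.starProjection (a.symm f)‖ ^ 2) :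
    ∃ h : H ≃ₗᵢ[𝕜] H, (∀ e : E, h (a e) = e) ∧
      ∀ f : F, h f = E.starProjection (a.symm f) + V (D f) := by
  let p : E × F →ₗ[𝕜] H :=
    (a.toLinearEquiv.toLinearMap ∘ₗ E.subtype).coprod F.subtype
  let q : E × F →ₗ[𝕜] H :=
    E.subtype.coprod ((E.starProjection : H →ₗ[𝕜] H) ∘ₗ a.symm.toLinearEquiv.toLinearMap ∘ₗ
      F.subtype + V.toLinearMap ∘ₗ D)
  have hp : ∀ e f, p (e, f) = a e + f := fun e f => rfl
  have hq : ∀ e f, q (e, f) = e + (E.starProjection (a.symm f) + V (D f)) := fun e f => rfl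
  have pyth : ∀ u ∈ E, ∀ w ∈ Eᗮ, ‖u + w‖ ^ 2 = ‖u‖ ^ 2 + ‖w‖ ^ 2 := fun u hu w hw => by
    simpa only [sq] using norm_add_sq_eq_norm_sq_add_norm_sq_of_inner_eq_zero u w (hw u hu)
  obtain ⟨h, hh⟩ := exists_unitary_comp_eq p q (by
    rintro ⟨e, f⟩
    have hE : (e : H) + E.starProjection (a.symm f) ∈ E :=
      E.add_mem e.2 (E.starProjection_apply_mem _)
    have hperp : a.symm f - E.starProjection (a.symm f) ∈ Eᗮ :=
      E.sub_starProjection_mem_orthogonal _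
    have h1 : ‖p (e, f)‖ =
        ‖((e : H) + E.starProjection (a.symm f)) + (a.symm f - E.starProjection (a.symm f))‖ := by
      rw [hp, ← a.symm.norm_map, map_add, a.symm_apply_apply]
      congr 1
      abel
    have h2 : ‖(f : H)‖ ^ 2 = ‖E.starProjection (a.symm f)‖ ^ 2 +
        ‖a.symm f - E.starProjection (a.symm f)‖ ^ 2 := by
      rw [← pyth _ (E.starProjection_apply_mem _) _ hperp, add_sub_cancel, a.symm.norm_map]
    have h3 : ‖D f‖ ^ 2 = ‖(f : H)‖ ^ 2 - ‖E.starProjection (a.symm f)‖ ^ 2 := hD f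
    rw [h2, add_sub_cancel_left] at h3
    refine (sq_eq_sq₀ (norm_nonneg _) (norm_nonneg _)).1 ?_
    rw [h1, pyth _ hE _ hperp, hq, ← add_assoc, pyth _ hE _ (hV _), V.norm_map, h3])
  refine ⟨h, fun e => ?_, fun f => ?_⟩
  · simpa [hp, hq] using hh (e, 0)
  · simpa [hp, hq] using hh (0, f)

/-- If the matrix coefficients of two unitaries `a` and `b` are close on `E × F`, then a unitary
close to the identity on `F` carries `a|_E` to `b|_E`. -/
theorem exists_unitary_near_one (hH : ¬ FiniteDimensional 𝕜 H) (E F : Submodule 𝕜 H)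
    [FiniteDimensional 𝕜 E] [FiniteDimensional 𝕜 F] {ε : ℝ} (hε : 0 < ε) :
    ∃ δ > 0, ∀ a b : H ≃ₗᵢ[𝕜] H,
      (∀ e ∈ E, ∀ f ∈ F, ‖⟪f, a e - b e⟫_𝕜‖ ≤ δ * ‖e‖ * ‖f‖) →
      ∃ h : H ≃ₗᵢ[𝕜] H, (∀ e ∈ E, h (a e) = b e) ∧ ∀ f ∈ F, ‖h f - f‖ ≤ ε * ‖f‖ := by
  obtain ⟨V, hV⟩ := exists_isometry_into_orthogonal hH E F
  -- `δ + √(2 * δ) ≤ ε`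
  refine ⟨min (ε / 2) (ε ^ 2 / 8), by positivity, fun a b hab => ?_⟩
  set δ := min (ε / 2) (ε ^ 2 / 8)
  have hT : ∀ (g : H ≃ₗᵢ[𝕜] H) (f : F), ‖E.starProjection (g.symm f)‖ ≤ ‖f‖ := fun g f => by
    simpa using E.norm_starProjection_apply_le (g.symm f)
  have hD : ∀ g : H ≃ₗᵢ[𝕜] H, ∃ D : F →ₗ[𝕜] F, D.IsPositive ∧
      ∀ f : F, ‖D f‖ ^ 2 = ‖f‖ ^ 2 - ‖E.starProjection (g.symm f)‖ ^ 2 := fun g =>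
    exists_defect ((E.orthogonalProjectionOnto : H →ₗ[𝕜] E) ∘ₗ g.symm.toLinearEquiv.toLinearMap ∘ₗ
      F.subtype) (hT g)
  obtain ⟨Da, hDa, hDa'⟩ := hD a
  obtain ⟨Db, hDb, hDb'⟩ := hD b
  obtain ⟨ha, hae, haf⟩ := exists_unitary_normal_form E F V hV a Da hDa'
  obtain ⟨hb, hbe, hbf⟩ := exists_unitary_normal_form E F V hV b Db hDb'
  have hTab : ∀ f : F,
      ‖E.starProjection (a.symm f) - E.starProjection (b.symm f)‖ ≤ δ * ‖f‖ := fun f => by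
    -- test the difference `e` of the projections against itself
    set e := E.starProjection (a.symm f) - E.starProjection (b.symm f) with he
    have heE : e ∈ E := E.sub_mem (E.starProjection_apply_mem _) (E.starProjection_apply_mem _)
    have h1 : ⟪e, e⟫_𝕜 = ⟪a e - b e, (f : H)⟫_𝕜 := by
      have h0 : ∀ g : H ≃ₗᵢ[𝕜] H, ⟪e, g.symm f⟫_𝕜 = ⟪g e, (f : H)⟫_𝕜 := fun g => by
        rw [← g.inner_map_map, g.apply_symm_apply]
      calc ⟪e, e⟫_𝕜 = ⟪e, E.starProjection (a.symm f - b.symm f)⟫_𝕜 := by rw [map_sub]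
        _ = _ := by
          rw [← E.inner_starProjection_left_eq_right, E.starProjection_eq_self_iff.2 heE,
            inner_sub_right, h0, h0, inner_sub_left]
    have h2 : ‖e‖ * ‖e‖ ≤ δ * ‖f‖ * ‖e‖ := by
      rw [← inner_self_eq_norm_mul_norm (𝕜 := 𝕜), h1]
      refine (RCLike.re_le_norm _).trans ?_
      rw [norm_inner_symm]
      exact (hab e heE f f.2).trans_eq (by rw [Submodule.coe_norm]; ring)
    rcases (norm_nonneg e).eq_or_lt with h0 | h0
    · rw [← h0]
      positivity
    · exact le_of_mul_le_mul_right h2 h0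
  have hDab : ∀ f : F, ‖Da f - Db f‖ ≤ ε / 2 * ‖f‖ := fun f => by
    have h1 := hDa.norm_sub_sq_le hDb (η := 2 * δ) (fun x => by
      rw [hDa', hDb', sub_sub_sub_cancel_left, sq_sub_sq, abs_mul]
      have h2 := abs_norm_sub_norm_le (E.starProjection (b.symm x)) (E.starProjection (a.symm x))
      rw [norm_sub_rev] at h2
      have h3 : |‖E.starProjection (b.symm x)‖ + ‖E.starProjection (a.symm x)‖| ≤ 2 * ‖x‖ := by
        rw [abs_of_nonneg (by positivity)]
        linarith [hT a x, hT b x]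
      calc _ ≤ (2 * ‖x‖) * (δ * ‖x‖) := by
            gcongr
            exact h2.trans (hTab x)
        _ = 2 * δ * ‖x‖ ^ 2 := by ring) f
    refine (sq_le_sq₀ (norm_nonneg _) (by positivity)).1 (h1.trans ?_)
    have : δ ≤ ε ^ 2 / 8 := min_le_right _ _
    calc 2 * δ * ‖f‖ ^ 2 ≤ 2 * (ε ^ 2 / 8) * ‖f‖ ^ 2 := by gcongr
      _ = (ε / 2 * ‖f‖) ^ 2 := by ring
  refine ⟨ha.trans hb.symm, fun e he => ?_, fun f hf => ?_⟩
  · rw [LinearIsometryEquiv.trans_apply, hae ⟨e, he⟩, LinearIsometryEquiv.symm_apply_eq]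
    exact (hbe ⟨e, he⟩).symm
  · rw [LinearIsometryEquiv.trans_apply, ← hb.norm_map, map_sub, hb.apply_symm_apply,
      haf ⟨f, hf⟩, hbf ⟨f, hf⟩, add_sub_add_comm, ← map_sub V]
    refine (norm_add_le _ _).trans ?_
    rw [V.norm_map]
    have h1 : δ ≤ ε / 2 := min_le_left _ _
    have h2 := hTab ⟨f, hf⟩
    have h3 := hDab ⟨f, hf⟩
    rw [Submodule.coe_norm] at h2 h3
    calc _ ≤ δ * ‖f‖ + ε / 2 * ‖f‖ := add_le_add h2 h3
      _ ≤ ε / 2 * ‖f‖ + ε / 2 * ‖f‖ := by gcongr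
      _ = ε * ‖f‖ := by ring

/-- A contraction of an infinite-dimensional Hilbert space agrees with a unitary, as far as the
matrix coefficients on a given finite-dimensional subspace are concerned. -/
theorem exists_unitary_dilation (hH : ¬ FiniteDimensional 𝕜 H) (F : Submodule 𝕜 H)
    [FiniteDimensional 𝕜 F] (T : H →L[𝕜] H) (hT : ‖T‖ ≤ 1) :
    ∃ h : H ≃ₗᵢ[𝕜] H, ∀ x ∈ F, ∀ y ∈ F, ⟪y, h x⟫_𝕜 = ⟪y, T x⟫_𝕜 := by
  obtain ⟨V, hV⟩ := exists_isometry_into_orthogonal hH F F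
  let A : F →ₗ[𝕜] F := (F.orthogonalProjectionOnto : H →ₗ[𝕜] F) ∘ₗ (T : H →ₗ[𝕜] H) ∘ₗ F.subtype
  have hA : ∀ x : F, (A x : H) = F.starProjection (T x) := fun x => rfl
  obtain ⟨D, -, hD⟩ := exists_defect A fun x => by
    rw [Submodule.coe_norm, hA]
    exact (F.norm_starProjection_apply_le _).trans ((T.le_of_opNorm_le hT _).trans_eq (one_mul _))
  obtain ⟨h, hh⟩ := exists_unitary_comp_eq F.subtype (F.subtype ∘ₗ A + V.toLinearMap ∘ₗ D)
    fun x => by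
      have e : (F.subtype ∘ₗ A + V.toLinearMap ∘ₗ D) x = (A x : H) + V (D x) := rfl
      have h1 := norm_add_sq_eq_norm_sq_add_norm_sq_of_inner_eq_zero (𝕜 := 𝕜) (A x : H) (V (D x))
        (hV _ _ (A x).2)
      have h2 := hD x
      rw [V.norm_map] at h1
      rw [e, ← mul_self_inj (norm_nonneg _) (norm_nonneg _), h1]
      simp only [Submodule.coe_norm, F.subtype_apply] at h2 ⊢
      linarith
  refine ⟨h, fun x hx y hy => ?_⟩
  have h1 : h x = F.starProjection (T x) + V (D ⟨x, hx⟩) := hh ⟨x, hx⟩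
  rw [h1, inner_add_right, hV _ y hy, add_zero, ← F.inner_starProjection_left_eq_right,
    F.starProjection_eq_self_iff.2 hy]

end Amalgamation

/-! ### Weak uniformities -/

section WeakUniformity

variable {𝕜 H : Type*} [RCLike 𝕜] [NormedAddCommGroup H] [InnerProductSpace 𝕜 H]

theorem Finset.exists_pos_forall_le {α : Type*} (s : Finset α) {ε : α → ℝ} (hε : ∀ a, 0 < ε a) :
    ∃ δ > 0, ∀ a ∈ s, δ ≤ ε a := by
  rcases s.eq_empty_or_nonempty with rfl | hne
  · exact ⟨1, one_pos, by simp⟩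
  · exact ⟨s.inf' hne ε, (Finset.lt_inf'_iff hne).2 fun a _ => hε a,
      fun a ha => Finset.inf'_le _ ha⟩

/-- The weak uniformity on `X` given by a family `ρ` of maps of `X` into an inner product space:
the coarsest uniformity for which all functions `x ↦ ⟪v, ρ i x⟫` are uniformly continuous. -/
@[reducible]
def weakUniformity (𝕜 : Type*) {H X ι : Type*} [RCLike 𝕜] [NormedAddCommGroup H]
    [InnerProductSpace 𝕜 H] (ρ : ι → X → H) : UniformSpace X :=
  UniformSpace.comap (fun x (p : ι × H) => ⟪p.2, ρ p.1 x⟫_𝕜) inferInstance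

variable {X ι : Type*} {ρ : ι → X → H}

theorem le_weakUniformity_iff {u : UniformSpace X} :
    u ≤ weakUniformity 𝕜 ρ ↔ ∀ i v, UniformContinuous[u, _] fun x => ⟪v, ρ i x⟫_𝕜 := by
  rw [← uniformContinuous_iff_le_comap, uniformContinuous_pi, Prod.forall]

theorem uniformContinuous_weakUniformity (i : ι) (v : H) :
    UniformContinuous[weakUniformity 𝕜 ρ, _] fun x => ⟪v, ρ i x⟫_𝕜 :=
  le_weakUniformity_iff.1 le_rfl i v

/-- A base of the weak uniformity. -/
theorem mem_weakUniformity {U : Set (X × X)} :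
    U ∈ 𝓤[weakUniformity 𝕜 ρ] ↔ ∃ s : Finset (ι × H), ∃ ε > 0, ∀ x y,
      (∀ p ∈ s, ‖⟪p.2, ρ p.1 x - ρ p.1 y⟫_𝕜‖ < ε) → (x, y) ∈ U := by
  rw [uniformity_comap, Pi.uniformity, Filter.comap_iInf]
  simp only [Filter.comap_comap]
  constructor
  · intro h
    obtain ⟨s, hs, W, hW, -, rfl, -⟩ := Filter.mem_iInf'.1 h
    have : ∀ p : ι × H, ∃ ε > 0, ∀ x y, ‖⟪p.2, ρ p.1 x - ρ p.1 y⟫_𝕜‖ < ε → (x, y) ∈ W p := by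
      intro p
      obtain ⟨t, ht, hW'⟩ := hW p
      obtain ⟨ε, hε, h'⟩ := Metric.mem_uniformity_dist.1 ht
      refine ⟨ε, hε, fun x y hxy => hW' (h' ?_)⟩
      simpa [dist_eq_norm, inner_sub_right] using hxy
    choose ε hε hW' using this
    lift s to Finset (ι × H) using hs
    obtain ⟨δ, hδ, hδ'⟩ := s.exists_pos_forall_le hε
    refine ⟨s, δ, hδ, fun x y hxy => mem_iInter₂.2 fun p hp => hW' p x y ?_⟩
    exact (hxy p hp).trans_le (hδ' p hp)
  · rintro ⟨s, ε, hε, h⟩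
    have : (⋂ p ∈ s, {q : X × X | ‖⟪p.2, ρ p.1 q.1 - ρ p.1 q.2⟫_𝕜‖ < ε}) ⊆ U :=
      fun q hq => h q.1 q.2 fun p hp => mem_iInter₂.1 hq p hp
    refine mem_of_superset ((Filter.biInter_finset_mem s).2 fun p _ => ?_) this
    refine Filter.mem_iInf_of_mem p ⟨_, Metric.dist_mem_uniformity hε, fun q hq => ?_⟩
    simpa [dist_eq_norm, inner_sub_right] using hq

theorem isUniformInducing_weakUniformity :
    @IsUniformInducing _ _ (weakUniformity 𝕜 ρ) _ fun x (p : ι × H) => ⟪p.2, ρ p.1 x⟫_𝕜 :=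
  (@isUniformInducing_iff_uniformSpace _ _ (weakUniformity 𝕜 ρ) _ _).2 rfl

/-- Bounded maps take their weak coordinates in a product of compact balls. -/
theorem totallyBounded_weakUniformity {c : ι → ℝ} (hc : ∀ i x, ‖ρ i x‖ ≤ c i) :
    IsTotallyBoundedUniformity (weakUniformity 𝕜 ρ) := by
  have hK : IsCompact (Set.univ.pi fun p : ι × H => Metric.closedBall (0 : 𝕜) (‖p.2‖ * c p.1)) :=
    isCompact_univ_pi fun p => isCompact_closedBall _ _
  have h := @totallyBounded_preimage _ _ (weakUniformity 𝕜 ρ) _ _ _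
    isUniformInducing_weakUniformity hK.totallyBounded
  have e : ((fun x (p : ι × H) => ⟪p.2, ρ p.1 x⟫_𝕜) ⁻¹'
      Set.univ.pi fun p : ι × H => Metric.closedBall (0 : 𝕜) (‖p.2‖ * c p.1)) = Set.univ :=
    Set.eq_univ_of_forall fun x p _ => mem_closedBall_zero_iff.2 <|
      (norm_inner_le_norm _ _).trans (mul_le_mul_of_nonneg_left (hc _ _) (norm_nonneg _))
  rwa [e] at h

theorem weakUniformity_eq_iInf :
    weakUniformity 𝕜 ρ = ⨅ i, ⨅ v, UniformSpace.comap (fun x => ⟪v, ρ i x⟫_𝕜) inferInstance := by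
  rw [weakUniformity, Pi.uniformSpace_eq, UniformSpace.comap_iInf, iInf_prod]
  simp only [← UniformSpace.comap_comap]
  rfl

theorem comap_weakUniformity {Y : Type*} (f : Y → X) :
    UniformSpace.comap f (weakUniformity 𝕜 ρ) = weakUniformity 𝕜 fun i y => ρ i (f y) := by
  rw [weakUniformity, ← UniformSpace.comap_comap]
  rfl

/-- On spheres, weak continuity implies continuity in norm. -/
theorem continuous_of_continuous_inner [TopologicalSpace X] {f : X → H} {c : ℝ}
    (hc : ∀ x, ‖f x‖ = c) (hf : ∀ v, Continuous fun x => ⟪v, f x⟫_𝕜) : Continuous f := by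
  refine continuous_iff_continuousAt.2 fun x => tendsto_iff_norm_sub_tendsto_zero.2 ?_
  have h2 : Tendsto (fun y => √(c ^ 2 - 2 * re ⟪f x, f y⟫_𝕜 + c ^ 2)) (𝓝 x)
      (𝓝 (√(c ^ 2 - 2 * re ⟪f x, f x⟫_𝕜 + c ^ 2))) :=
    ((((RCLike.continuous_re.tendsto _).comp ((hf (f x)).tendsto x)).const_mul 2).const_sub _
      |>.add_const _).sqrt
  rw [inner_self_eq_norm_sq, hc, show c ^ 2 - 2 * c ^ 2 + c ^ 2 = 0 by ring, Real.sqrt_zero] at h2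
  -- `‖f y - f x‖ ^ 2 = 2 * c ^ 2 - 2 * re ⟪f x, f y⟫`
  refine h2.congr fun y => ?_
  rw [norm_sub_rev, ← Real.sqrt_sq (norm_nonneg (f x - f y)), norm_sub_sq (𝕜 := 𝕜), hc, hc]

/-- If each `ρ i` takes its values in a sphere, then the weak uniformity induces the topology which
the maps `ρ i` induce from the norm topology. -/
theorem toTopologicalSpace_weakUniformity [tX : TopologicalSpace X]
    (hρ : IsInducing fun x i => ρ i x) {c : ι → ℝ} (hc : ∀ i x, ‖ρ i x‖ = c i) :
    (weakUniformity 𝕜 ρ).toTopologicalSpace = tX := by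
  refine le_antisymm ?_ ?_
  · rw [hρ.eq_induced, ← continuous_iff_le_induced]
    refine @continuous_pi _ _ _ (weakUniformity 𝕜 ρ).toTopologicalSpace _ _ fun i => ?_
    exact @continuous_of_continuous_inner 𝕜 H _ _ _ X (weakUniformity 𝕜 ρ).toTopologicalSpace _ _
      (hc i) fun v => @UniformContinuous.continuous _ _ (weakUniformity 𝕜 ρ) _ _
        (uniformContinuous_weakUniformity i v)
  · have : (weakUniformity 𝕜 ρ).toTopologicalSpace =
        TopologicalSpace.induced (fun x (p : ι × H) => ⟪p.2, ρ p.1 x⟫_𝕜) inferInstance := rfl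
    rw [this, ← continuous_iff_le_induced]
    exact continuous_pi fun p => continuous_const.inner ((continuous_apply p.1).comp hρ.continuous)

theorem inner_unitary_apply (g : UnitaryGroup 𝕜 H) (v x : H) : ⟪v, g x⟫_𝕜 = ⟪g⁻¹ v, x⟫_𝕜 := by
  rw [← g.inner_map_map (g⁻¹ v) x]
  congr 1
  exact (g.apply_symm_apply v).symm

/-- The weak uniformity given by equivariant maps into spheres is an equiuniformity for the strong
operator topology on the unitary group. -/
theorem isEquiuniformity_weakUniformity [tX : TopologicalSpace X] [MulAction (UnitaryGroup 𝕜 H) X]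
    (hρ : IsInducing fun x i => ρ i x) {c : ι → ℝ} (hc : ∀ i x, ‖ρ i x‖ = c i)
    (hG : ∀ i x (g : UnitaryGroup 𝕜 H), ρ i (g • x) = g (ρ i x)) :
    IsEquiuniformity (UnitaryGroup 𝕜 H) (weakUniformity 𝕜 ρ) where
  compatible := toTopologicalSpace_weakUniformity hρ hc
  saturated g := by
    rw [uniformContinuous_iff_le_comap, comap_weakUniformity, le_weakUniformity_iff]
    intro i v
    simp only [hG, inner_unitary_apply]
    exact uniformContinuous_weakUniformity i _
  bounded U hU := by
    obtain ⟨s, ε, hε, h⟩ := mem_weakUniformity.1 hU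
    have hO : ∀ᶠ g : UnitaryGroup 𝕜 H in 𝓝 1, ∀ p ∈ s, ‖p.2 - g⁻¹ p.2‖ * c p.1 < ε / 2 := by
      refine (Filter.eventually_all_finset s).2 fun p _ => ?_
      have h1 := unitary_tendsto_iff.1 (continuous_inv.tendsto (1 : UnitaryGroup 𝕜 H)) p.2
      have h2 := ((h1.const_sub p.2).norm.mul_const (c p.1))
      rw [inv_one, LinearIsometryEquiv.coe_one, id, sub_self, norm_zero, zero_mul] at h2
      exact h2.eventually_lt_const (half_pos hε)
    refine ⟨_, hO, {q | ∀ p ∈ s, ‖⟪p.2, ρ p.1 q.1 - ρ p.1 q.2⟫_𝕜‖ < ε / 2},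
      mem_weakUniformity.2 ⟨s, ε / 2, half_pos hε, fun x y hxy => hxy⟩,
      fun x => ⟨x, fun g hg z hz => h _ _ fun p hp => ?_⟩⟩
    have e : ⟪p.2, ρ p.1 x - ρ p.1 (g • z)⟫_𝕜 =
        ⟪p.2, ρ p.1 x - ρ p.1 z⟫_𝕜 + ⟪p.2 - g⁻¹ p.2, ρ p.1 z⟫_𝕜 := by
      rw [hG, inner_sub_right, inner_unitary_apply, inner_sub_right, inner_sub_left]
      ring
    rw [e]
    calc _ ≤ ‖⟪p.2, ρ p.1 x - ρ p.1 z⟫_𝕜‖ + ‖p.2 - g⁻¹ p.2‖ * c p.1 :=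
          (norm_add_le _ _).trans
            (add_le_add_right ((norm_inner_le_norm _ _).trans_eq (by rw [hc])) _)
      _ < ε / 2 + ε / 2 := add_lt_add (hz p hp) (hg p hp)
      _ = ε := add_halves ε

end WeakUniformity

/-! ### The Roelcke uniformity of the unitary group -/

section Roelcke

variable {𝕜 H : Type*} [RCLike 𝕜] [NormedAddCommGroup H] [InnerProductSpace 𝕜 H]

theorem mem_stabilizerUniformity {G X : Type*} [Group G] [TopologicalSpace G]
    [IsTopologicalGroup G] [MulAction G X] {U : Set (G × G)} :
    U ∈ 𝓤[stabilizerUniformity G X] ↔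
      ∃ O ∈ 𝓝 (1 : G), ∃ σ : Finset X, stabilizerEntourage O σ ⊆ U := by
  refine (FilterBasis.mem_filter_iff _).trans ⟨?_, ?_⟩
  · rintro ⟨_, ⟨O, hO, σ, rfl⟩, h⟩
    exact ⟨O, hO, σ, h⟩
  · rintro ⟨O, hO, σ, h⟩
    exact ⟨_, ⟨O, hO, σ, rfl⟩, h⟩

/-- If pointwise stabilizers of finite sets are arbitrarily small, then `O g St_σ` is contained in
a product of a small left and a small right translation. -/
theorem stabilizerUniformity_le_roelckeUniformity {G X : Type*} [Group G] [TopologicalSpace G]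
    [IsTopologicalGroup G] [MulAction G X]
    (h : ∀ O ∈ 𝓝 (1 : G), ∃ σ : Finset X, (fixingSubgroup G (σ : Set X) : Set G) ⊆ O) :
    stabilizerUniformity G X ≤ roelckeUniformity G := by
  intro U hU
  obtain ⟨V, hV, hVU⟩ := @comp_mem_uniformity_sets _ (roelckeUniformity G) _ hU
  have hL : V ∈ 𝓤[IsTopologicalGroup.leftUniformSpace G] :=
    (le_sup_left : IsTopologicalGroup.leftUniformSpace G ≤ roelckeUniformity G) hV
  have hR : V ∈ 𝓤[IsTopologicalGroup.rightUniformSpace G] :=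
    (le_sup_right : IsTopologicalGroup.rightUniformSpace G ≤ roelckeUniformity G) hV
  obtain ⟨O, hO, hOV⟩ := hL
  obtain ⟨O', hO', hOV'⟩ := hR
  obtain ⟨σ, hσ⟩ := h O hO
  refine mem_stabilizerUniformity.2 ⟨O', hO', σ, ?_⟩
  rintro ⟨a, b⟩ ⟨g, hg, s, hs, rfl : b = g * a * s⟩
  exact hVU ⟨g * a, hOV' (by simpa using hg), hOV (by simpa [mul_assoc] using hσ hs)⟩

variable (𝕜 H) in
/-- The uniformity on the unitary group given by the matrix coefficients, that is, the uniformity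
induced from the weak operator topology. -/
@[reducible]
def operatorWeakUniformity : UniformSpace (UnitaryGroup 𝕜 H) :=
  weakUniformity 𝕜 fun (x : UnitSphere H) (g : UnitaryGroup 𝕜 H) => g (x : H)

theorem isInducing_unitary :
    IsInducing fun (g : UnitaryGroup 𝕜 H) (x : UnitSphere H) => g (x : H) :=
  (IsInducing.piMap fun _ : UnitSphere H =>
    (IsInducing.subtypeVal : IsInducing (Subtype.val : UnitSphere H → H))).comp
    (⟨rfl⟩ : IsInducing fun (g : UnitaryGroup 𝕜 H) (x : UnitSphere H) => g • x)

theorem norm_unitary_sphere (x : UnitSphere H) (g : UnitaryGroup 𝕜 H) : ‖g (x : H)‖ = 1 := by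
  rw [g.norm_map]
  exact norm_eq_of_mem_sphere x

theorem uniformContinuous_operatorWeakUniformity (v x : H) :
    UniformContinuous[operatorWeakUniformity 𝕜 H, _] fun g : UnitaryGroup 𝕜 H => ⟪v, g x⟫_𝕜 := by
  rcases eq_or_ne x 0 with rfl | hx
  · simp only [map_zero, inner_zero_right]
    exact @uniformContinuous_const _ _ (operatorWeakUniformity 𝕜 H) _ _
  · have hn : ‖x‖ ≠ 0 := norm_ne_zero_iff.2 hx
    have h1 := uniformContinuous_weakUniformity (𝕜 := 𝕜)
      (ρ := fun (x : UnitSphere H) (g : UnitaryGroup 𝕜 H) => g (x : H))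
      ⟨(‖x‖⁻¹ : 𝕜) • x, by simp [norm_smul, hn]⟩ ((‖x‖ : 𝕜) • v)
    convert h1 using 2 with g
    rw [map_smul, inner_smul_left, inner_smul_right, ← mul_assoc, RCLike.conj_ofReal,
      mul_inv_cancel₀ (by exact_mod_cast hn), one_mul]

/-- `⟪v, a x⟫ - ⟪v, b x⟫ = ⟪a⁻¹ v, x - a⁻¹ b x⟫` is small, uniformly in `a`, if `a⁻¹ b` is close to
the identity. -/
theorem leftUniformSpace_le_operatorWeakUniformity :
    IsTopologicalGroup.leftUniformSpace (UnitaryGroup 𝕜 H) ≤ operatorWeakUniformity 𝕜 H := by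
  rw [le_weakUniformity_iff]
  intro x v
  refine (@Metric.uniformity_basis_dist 𝕜 _).tendsto_right_iff.2 fun ε hε => ?_
  have h1 := (unitary_tendsto_iff.1 (tendsto_id (x := 𝓝 (1 : UnitaryGroup 𝕜 H))) x)
  have h2 := ((h1.const_sub (x : H)).norm.const_mul ‖v‖)
  simp only [id, LinearIsometryEquiv.coe_one, sub_self, norm_zero, mul_zero] at h2
  refine mem_of_superset (preimage_mem_comap (h2.eventually_lt_const hε)) ?_
  rintro ⟨a, b⟩ (hab : ‖v‖ * ‖(x : H) - (a⁻¹ * b) (x : H)‖ < ε)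
  refine lt_of_le_of_lt ?_ hab
  have e : ⟪v, a (x : H)⟫_𝕜 - ⟪v, b (x : H)⟫_𝕜 = ⟪a⁻¹ v, (x : H) - (a⁻¹ * b) (x : H)⟫_𝕜 := by
    rw [inner_sub_right, inner_unitary_apply a]
    exact congrArg _ ((a⁻¹).inner_map_map v (b x)).symm
  rw [dist_eq_norm, e]
  exact (norm_inner_le_norm _ _).trans_eq (by rw [LinearIsometryEquiv.norm_map])

/-- `⟪v, a x⟫ - ⟪v, b x⟫ = ⟪v - (b a⁻¹)⁻¹ v, a x⟫` is small, uniformly in `a`, if `b a⁻¹` is close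
to the identity. -/
theorem rightUniformSpace_le_operatorWeakUniformity :
    IsTopologicalGroup.rightUniformSpace (UnitaryGroup 𝕜 H) ≤ operatorWeakUniformity 𝕜 H := by
  rw [le_weakUniformity_iff]
  intro x v
  refine (@Metric.uniformity_basis_dist 𝕜 _).tendsto_right_iff.2 fun ε hε => ?_
  have h1 := unitary_tendsto_iff.1 (continuous_inv.tendsto (1 : UnitaryGroup 𝕜 H)) v
  have h2 := (h1.const_sub v).norm
  rw [inv_one, LinearIsometryEquiv.coe_one, id, sub_self, norm_zero] at h2
  refine mem_of_superset (preimage_mem_comap (h2.eventually_lt_const hε)) ?_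
  rintro ⟨a, b⟩ (hab : ‖v - (b * a⁻¹)⁻¹ v‖ < ε)
  refine lt_of_le_of_lt ?_ hab
  have e : ⟪v, a (x : H)⟫_𝕜 - ⟪v, b (x : H)⟫_𝕜 = ⟪v - (b * a⁻¹)⁻¹ v, a (x : H)⟫_𝕜 := by
    rw [inner_sub_left, ← inner_unitary_apply]
    exact congrArg (fun y => _ - ⟪v, b y⟫_𝕜) (a.symm_apply_apply (x : H)).symm
  rw [dist_eq_norm, e]
  exact (norm_inner_le_norm _ _).trans_eq (by rw [norm_unitary_sphere, mul_one])

theorem exists_finset_of_mem_nhds_one {O : Set (UnitaryGroup 𝕜 H)} (hO : O ∈ 𝓝 1) :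
    ∃ s : Finset (UnitSphere H), ∃ ε > 0, ∀ h : UnitaryGroup 𝕜 H,
      (∀ x ∈ s, ‖h (x : H) - x‖ < ε) → h ∈ O := by
  rw [isInducing_unitary.nhds_eq_comap, nhds_pi] at hO
  obtain ⟨t, ht, htO⟩ := hO
  obtain ⟨s, W, hW, hWt⟩ := Filter.mem_pi'.1 ht
  have : ∀ x : UnitSphere H, ∃ ε > 0, Metric.ball (x : H) ε ⊆ W x := fun x =>
    Metric.mem_nhds_iff.1 (hW x)
  choose ε hε hεW using this
  obtain ⟨δ, hδ, hδ'⟩ := s.exists_pos_forall_le hε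
  refine ⟨s, δ, hδ, fun h hh => htO (hWt fun x hx => hεW x ?_)⟩
  rw [Metric.mem_ball, dist_eq_norm]
  exact (hh x hx).trans_le (hδ' x hx)

/-- Closeness on the vectors of an orthonormal basis of `F` gives closeness on `F`, uniformly on
bounded sets. -/
theorem mem_weakUniformity_of_finiteDimensional {X ι : Type*} (ρ : ι → X → H) (i : ι)
    (F : Submodule 𝕜 H) [FiniteDimensional 𝕜 F] {δ : ℝ} (hδ : 0 < δ) :
    {p : X × X | ∀ f ∈ F, ‖⟪f, ρ i p.1 - ρ i p.2⟫_𝕜‖ ≤ δ * ‖f‖} ∈ 𝓤[weakUniformity 𝕜 ρ] := by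
  classical
  set b := stdOrthonormalBasis 𝕜 F
  set n := Module.finrank 𝕜 F
  -- `n + 1` rather than `n`, since `F` may be zero
  refine mem_weakUniformity.2 ⟨Finset.univ.image fun j => (i, (b j : H)), δ / (n + 1),
    by positivity, fun x y hxy f hf => ?_⟩
  have hxy' : ∀ j, ‖⟪(b j : H), ρ i x - ρ i y⟫_𝕜‖ ≤ δ / (n + 1) := fun j =>
    (hxy (i, b j) (Finset.mem_image_of_mem _ (Finset.mem_univ j))).le
  have hf' : f = ∑ j, ⟪b j, (⟨f, hf⟩ : F)⟫_𝕜 • (b j : H) := by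
    have := congrArg Subtype.val (b.sum_repr' ⟨f, hf⟩)
    rw [Submodule.coe_sum] at this
    exact this.symm
  have hc : ∀ j, ‖⟪b j, (⟨f, hf⟩ : F)⟫_𝕜‖ ≤ ‖f‖ := fun j =>
    (norm_inner_le_norm _ _).trans_eq (by rw [b.orthonormal.1 j, one_mul]; rfl)
  calc ‖⟪f, ρ i x - ρ i y⟫_𝕜‖
      = ‖∑ j, (starRingEnd 𝕜) ⟪b j, (⟨f, hf⟩ : F)⟫_𝕜 * ⟪(b j : H), ρ i x - ρ i y⟫_𝕜‖ := by
        conv_lhs => rw [hf']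
        rw [sum_inner]
        simp only [inner_smul_left]
    _ ≤ ∑ j : Fin n, ‖f‖ * (δ / (n + 1)) := by
        refine (norm_sum_le _ _).trans (Finset.sum_le_sum fun j _ => ?_)
        rw [norm_mul, RCLike.norm_conj]
        exact mul_le_mul (hc j) (hxy' j) (norm_nonneg _) (norm_nonneg _)
    _ = (n / (n + 1)) * (δ * ‖f‖) := by
        rw [Finset.sum_const, Finset.card_univ, Fintype.card_fin, nsmul_eq_mul]
        ring
    _ ≤ 1 * (δ * ‖f‖) := by
        gcongr
        exact (div_le_one (by positivity)).2 (by linarith)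
    _ = δ * ‖f‖ := one_mul _

/-- The compressions of `a` and `b` to maps from `E` to `F` are close in norm if finitely many
matrix coefficients are close. -/
theorem mem_operatorWeakUniformity_of_finiteDimensional (E F : Submodule 𝕜 H)
    [FiniteDimensional 𝕜 E] [FiniteDimensional 𝕜 F] {δ : ℝ} (hδ : 0 < δ) :
    {p : UnitaryGroup 𝕜 H × UnitaryGroup 𝕜 H |
      ∀ e ∈ E, ∀ f ∈ F, ‖⟪f, p.1 e - p.2 e⟫_𝕜‖ ≤ δ * ‖e‖ * ‖f‖} ∈
      𝓤[operatorWeakUniformity 𝕜 H] := by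
  set b := stdOrthonormalBasis 𝕜 E
  set n := Module.finrank 𝕜 E
  have hb : ∀ j, ‖(b j : H)‖ = 1 := fun j => b.orthonormal.1 j
  have hδ' : 0 < δ / (n + 1) := by positivity
  refine mem_of_superset (Filter.iInter_mem.2 fun j => mem_weakUniformity_of_finiteDimensional
    (fun (x : UnitSphere H) (g : UnitaryGroup 𝕜 H) => g (x : H))
    ⟨b j, mem_sphere_zero_iff_norm.2 (hb j)⟩ F hδ') ?_
  rintro ⟨g, g'⟩ hg e he f hf
  have hg' : ∀ j, ‖⟪f, g (b j : H) - g' (b j : H)⟫_𝕜‖ ≤ δ / (n + 1) * ‖f‖ := fun j =>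
    mem_iInter.1 hg j f hf
  have he' : e = ∑ j, ⟪b j, (⟨e, he⟩ : E)⟫_𝕜 • (b j : H) := by
    have := congrArg Subtype.val (b.sum_repr' ⟨e, he⟩)
    rw [Submodule.coe_sum] at this
    exact this.symm
  have hc : ∀ j, ‖⟪b j, (⟨e, he⟩ : E)⟫_𝕜‖ ≤ ‖e‖ := fun j =>
    (norm_inner_le_norm _ _).trans_eq (by rw [b.orthonormal.1 j, one_mul]; rfl)
  calc ‖⟪f, g e - g' e⟫_𝕜‖
      = ‖∑ j, ⟪b j, (⟨e, he⟩ : E)⟫_𝕜 * ⟪f, g (b j : H) - g' (b j : H)⟫_𝕜‖ := by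
        conv_lhs => rw [he']
        rw [map_sum, map_sum, ← Finset.sum_sub_distrib, inner_sum]
        simp only [map_smul, ← smul_sub, inner_smul_right]
    _ ≤ ∑ j : Fin n, ‖e‖ * (δ / (n + 1) * ‖f‖) := by
        refine (norm_sum_le _ _).trans (Finset.sum_le_sum fun j _ => ?_)
        rw [norm_mul]
        exact mul_le_mul (hc j) (hg' j) (norm_nonneg _) (norm_nonneg _)
    _ = (n / (n + 1)) * (δ * ‖e‖ * ‖f‖) := by
        rw [Finset.sum_const, Finset.card_univ, Fintype.card_fin, nsmul_eq_mul]
        ring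
    _ ≤ 1 * (δ * ‖e‖ * ‖f‖) := by
        gcongr
        exact (div_le_one (by positivity)).2 (by linarith)
    _ = δ * ‖e‖ * ‖f‖ := one_mul _

/-- Unitaries with close matrix coefficients are, on a finite-dimensional subspace, translates of
each other by an element close to the identity. -/
theorem mem_operatorWeakUniformity_of_mem_nhds_one (E : Submodule 𝕜 H) [FiniteDimensional 𝕜 E]
    {O : Set (UnitaryGroup 𝕜 H)} (hO : O ∈ 𝓝 1) :
    {p : UnitaryGroup 𝕜 H × UnitaryGroup 𝕜 H | ∃ h ∈ O, ∀ e ∈ E, h (p.1 e) = p.2 e} ∈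
      𝓤[operatorWeakUniformity 𝕜 H] := by
  obtain ⟨s, ε, hε, hs⟩ := exists_finset_of_mem_nhds_one hO
  by_cases hH : FiniteDimensional 𝕜 H
  · refine mem_of_superset
      (mem_operatorWeakUniformity_of_finiteDimensional ⊤ ⊤ (half_pos hε)) ?_
    rintro ⟨a, b⟩ hab
    -- here `a` and `b` are close in norm, and `b * a⁻¹` carries `a` to `b`
    have hab' : ∀ e : H, ‖a e - b e‖ ≤ ε / 2 * ‖e‖ := fun e => by
      have h := hab e trivial (a e - b e) trivial
      rw [inner_self_eq_norm_sq_to_K, norm_pow, RCLike.norm_ofReal, abs_norm, sq] at h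
      rcases (norm_nonneg (a e - b e)).eq_or_lt with h0 | h0
      · rw [← h0]
        positivity
      · exact le_of_mul_le_mul_right h h0
    refine ⟨b * a⁻¹, hs _ fun x _ => ?_, fun e _ => ?_⟩
    · have h := hab' (a⁻¹ x)
      have e : a (a⁻¹ (x : H)) = x := a.apply_symm_apply x
      rw [e, LinearIsometryEquiv.norm_map, norm_eq_of_mem_sphere x, norm_sub_rev] at h
      exact h.trans_lt (by linarith)
    · exact congrArg b (a.symm_apply_apply e)
  · let F : Submodule 𝕜 H := Submodule.span 𝕜 ((↑) '' (s : Set (UnitSphere H)))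
    have : FiniteDimensional 𝕜 F :=
      FiniteDimensional.span_of_finite 𝕜 (s.finite_toSet.image _)
    obtain ⟨δ, hδ, h⟩ := exists_unitary_near_one hH E F (half_pos hε)
    refine mem_of_superset (mem_operatorWeakUniformity_of_finiteDimensional E F hδ) ?_
    rintro ⟨a, b⟩ hab
    obtain ⟨g, hg, hgF⟩ := h a b hab
    refine ⟨g, hs g fun x hx => ?_, hg⟩
    have := hgF x (Submodule.subset_span ⟨x, hx, rfl⟩)
    rw [norm_eq_of_mem_sphere x] at this
    exact this.trans_lt (by linarith)

/-- The left, right, stabilizer and matrix coefficient uniformities satisfy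
`L ∧ R ≤ R_Σ ≤ W ≤ L ∧ R` in the order in which finer uniformities are larger. The stabilizers may
be taken for any invariant set of vectors which contains the unit sphere. -/
theorem roelckeUniformity_eq_and_stabilizerUniformity_eq {X : Type*}
    [MulAction (UnitaryGroup 𝕜 H) X] {f : X → H} (hf : Function.Injective f)
    (hG : ∀ (g : UnitaryGroup 𝕜 H) x, f (g • x) = g (f x))
    (hS : ∀ x : UnitSphere H, ∃ y, f y = x) :
    roelckeUniformity (UnitaryGroup 𝕜 H) = operatorWeakUniformity 𝕜 H ∧
      stabilizerUniformity (UnitaryGroup 𝕜 H) X = operatorWeakUniformity 𝕜 H := by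
  classical
  have h1 : roelckeUniformity (UnitaryGroup 𝕜 H) ≤ operatorWeakUniformity 𝕜 H :=
    sup_le leftUniformSpace_le_operatorWeakUniformity rightUniformSpace_le_operatorWeakUniformity
  have h2 : operatorWeakUniformity 𝕜 H ≤ stabilizerUniformity (UnitaryGroup 𝕜 H) X := by
    intro U hU
    obtain ⟨O, hO, σ, hσ⟩ := mem_stabilizerUniformity.1 hU
    let E : Submodule 𝕜 H := Submodule.span 𝕜 (f '' (σ : Set X))
    have : FiniteDimensional 𝕜 E := FiniteDimensional.span_of_finite 𝕜 (σ.finite_toSet.image _)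
    refine mem_of_superset (mem_operatorWeakUniformity_of_mem_nhds_one E hO) ?_
    rintro ⟨a, b⟩ ⟨h, hh, hE⟩
    -- `b = h * a * s`, and `s` fixes `x` because `h (a x) = b x`
    refine hσ ⟨h, hh, (h * a)⁻¹ * b, ?_, (mul_inv_cancel_left (h * a) b).symm⟩
    rw [mem_fixingSubgroup_iff]
    intro x hx
    rw [mul_smul, inv_smul_eq_iff]
    refine hf ?_
    rw [hG, hG]
    exact (hE (f x) (Submodule.subset_span ⟨x, hx, rfl⟩)).symm
  have h3 : stabilizerUniformity (UnitaryGroup 𝕜 H) X ≤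
      roelckeUniformity (UnitaryGroup 𝕜 H) := by
    refine stabilizerUniformity_le_roelckeUniformity fun O hO => ?_
    obtain ⟨s, ε, hε, hs⟩ := exists_finset_of_mem_nhds_one hO
    choose y hy using hS
    refine ⟨s.image y, fun g hg => hs g fun x hx => ?_⟩
    have h := (mem_fixingSubgroup_iff _).1 hg (y x) (Finset.mem_image_of_mem y hx)
    have h' := hG g (y x)
    rw [h, hy] at h'
    rwa [← h', sub_self, norm_zero]
  exact ⟨le_antisymm h1 (h2.trans h3), le_antisymm (h3.trans h1) h2⟩

variable (𝕜 H)

theorem roelckeUniformity_eq_operatorWeakUniformity :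
    roelckeUniformity (UnitaryGroup 𝕜 H) = operatorWeakUniformity 𝕜 H :=
  (roelckeUniformity_eq_and_stabilizerUniformity_eq (X := UnitSphere H) Subtype.val_injective
    (fun _ _ => rfl) fun x => ⟨x, rfl⟩).1

theorem stabilizerUniformity_sphere_eq_operatorWeakUniformity :
    stabilizerUniformity (UnitaryGroup 𝕜 H) (UnitSphere H) = operatorWeakUniformity 𝕜 H :=
  (roelckeUniformity_eq_and_stabilizerUniformity_eq (X := UnitSphere H) Subtype.val_injective
    (fun _ _ => rfl) fun x => ⟨x, rfl⟩).2

theorem stabilizerUniformity_ball_eq_operatorWeakUniformity :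
    stabilizerUniformity (UnitaryGroup 𝕜 H) (UnitBall H) = operatorWeakUniformity 𝕜 H :=
  (roelckeUniformity_eq_and_stabilizerUniformity_eq (X := UnitBall H) Subtype.val_injective
    (fun _ _ => rfl) fun x => ⟨⟨x, Metric.sphere_subset_closedBall x.2⟩, rfl⟩).2

end Roelcke

/-! ### The maximal equiuniformity on the sphere -/

section Sphere

variable {𝕜 H : Type*} [RCLike 𝕜] [NormedAddCommGroup H] [InnerProductSpace 𝕜 H]

variable (𝕜 H) in
/-- The uniformity on the unit sphere given by the weak topology. -/
@[reducible]
def sphereWeakUniformity : UniformSpace (UnitSphere H) :=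
  weakUniformity 𝕜 fun (_ : Unit) (x : UnitSphere H) => (x : H)

theorem isInducing_sphere : IsInducing fun (x : UnitSphere H) (_ : Unit) => (x : H) :=
  (Homeomorph.funUnique Unit H).symm.isInducing.comp
    (IsInducing.subtypeVal : IsInducing (Subtype.val : UnitSphere H → H))

variable (𝕜 H) in
theorem isEquiuniformity_sphereWeakUniformity :
    IsEquiuniformity (UnitaryGroup 𝕜 H) (sphereWeakUniformity 𝕜 H) :=
  isEquiuniformity_weakUniformity isInducing_sphere (c := fun _ => 1)
    (fun _ x => norm_eq_of_mem_sphere x) fun _ _ _ => rfl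

theorem exists_unitary_apply_eq {x y : H} (h : ‖x‖ = ‖y‖) : ∃ g : UnitaryGroup 𝕜 H, g x = y := by
  obtain ⟨g, hg⟩ := exists_unitary_comp_eq (LinearMap.toSpanSingleton 𝕜 H x)
    (LinearMap.toSpanSingleton 𝕜 H y) fun c => by simp [norm_smul, h]
  exact ⟨g, by simpa using hg 1⟩

/-- Weakly close points of the sphere lie in a common small orbit piece `O x`. -/
theorem mem_sphereWeakUniformity_of_mem_nhds_one (hH : ¬ FiniteDimensional 𝕜 H)
    {O : Set (UnitaryGroup 𝕜 H)} (hO : O ∈ 𝓝 1) :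
    {p : UnitSphere H × UnitSphere H | ∃ h ∈ O, h • p.1 = p.2} ∈
      𝓤[sphereWeakUniformity 𝕜 H] := by
  obtain ⟨s, ε, hε, hs⟩ := exists_finset_of_mem_nhds_one hO
  rcases isEmpty_or_nonempty (UnitSphere H) with hS | ⟨⟨x₀⟩⟩
  · convert Filter.univ_mem using 1
    exact Subsingleton.elim _ _
  let E : Submodule 𝕜 H := Submodule.span 𝕜 {(x₀ : H)}
  let F : Submodule 𝕜 H := Submodule.span 𝕜 ((↑) '' (s : Set (UnitSphere H)))
  have : FiniteDimensional 𝕜 F := FiniteDimensional.span_of_finite 𝕜 (s.finite_toSet.image _)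
  obtain ⟨δ, hδ, h⟩ := exists_unitary_near_one hH E F (half_pos hε)
  refine mem_of_superset (mem_weakUniformity_of_finiteDimensional _ () F hδ) ?_
  rintro ⟨x, y⟩ hxy
  -- `x` and `y` are the values at `x₀` of two unitaries
  obtain ⟨a, ha⟩ := exists_unitary_apply_eq (𝕜 := 𝕜) (x := (x₀ : H)) (y := x)
    (by rw [norm_eq_of_mem_sphere, norm_eq_of_mem_sphere])
  obtain ⟨b, hb⟩ := exists_unitary_apply_eq (𝕜 := 𝕜) (x := (x₀ : H)) (y := y)
    (by rw [norm_eq_of_mem_sphere, norm_eq_of_mem_sphere])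
  obtain ⟨g, hg, hgF⟩ := h a b fun e he f hf => by
    obtain ⟨c, rfl⟩ := Submodule.mem_span_singleton.1 he
    have h1 : ‖⟪f, (x : H) - y⟫_𝕜‖ ≤ δ * ‖f‖ := hxy f hf
    rw [map_smul, map_smul, ← smul_sub, inner_smul_right, norm_mul, norm_smul, ha, hb,
      norm_eq_of_mem_sphere x₀, mul_one]
    calc ‖c‖ * ‖⟪f, (x : H) - y⟫_𝕜‖ ≤ ‖c‖ * (δ * ‖f‖) := by gcongr
      _ = δ * ‖c‖ * ‖f‖ := by ring
  refine ⟨g, hs g fun z hz => ?_, Subtype.ext ?_⟩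
  · have := hgF z (Submodule.subset_span ⟨z, hz, rfl⟩)
    rw [norm_eq_of_mem_sphere z] at this
    exact this.trans_lt (by linarith)
  · have := hg x₀ (Submodule.mem_span_singleton_self _)
    rwa [ha, hb] at this

/-- For an equiuniformity, the orbit pieces `O x` are uniformly small. -/
theorem IsEquiuniformity.exists_mem_nhds_one {G X : Type*} [Group G] [TopologicalSpace G]
    [MulAction G X] [TopologicalSpace X] {u : UniformSpace X} (hu : IsEquiuniformity G u)
    {U : Set (X × X)} (hU : U ∈ 𝓤[u]) :
    ∃ O ∈ 𝓝 (1 : G), {p : X × X | ∃ h ∈ O, h • p.1 = p.2} ⊆ U := by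
  obtain ⟨V, hV, hVs, hVU⟩ := @comp_symm_mem_uniformity_sets _ u _ hU
  obtain ⟨O, hO, W, hW, h⟩ := hu.bounded V hV
  refine ⟨O, hO, ?_⟩
  rintro ⟨x, y⟩ ⟨g, hg, rfl : g • x = y⟩
  obtain ⟨z, hz⟩ := h x
  have hx : (x, x) ∈ W := @refl_mem_uniformity _ u _ _ hW
  -- `x` and `g • x` both lie in `O x`, which is small of order `V` around `z`
  have h1 := hz 1 (mem_of_mem_nhds hO) x hx
  rw [one_smul] at h1
  exact hVU ⟨z, hVs.symm _ _ h1, hz g hg x hx⟩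

variable (𝕜 H) in
/-- The weak uniformity is the maximal equiuniformity on the sphere. In infinite dimension this is
due to the transitivity of the action; a finite-dimensional sphere is compact and carries only one
uniformity. -/
theorem maxEquiuniformity_sphere_eq :
    maxEquiuniformity (UnitaryGroup 𝕜 H) (UnitSphere H) = sphereWeakUniformity 𝕜 H := by
  have hw := isEquiuniformity_sphereWeakUniformity 𝕜 H
  refine le_antisymm (sInf_le hw) (le_sInf fun u hu => ?_)
  by_cases hH : FiniteDimensional 𝕜 H
  · have : ProperSpace H := FiniteDimensional.proper_rclike 𝕜 H
    exact (unique_uniformity_of_compact hw.compatible hu.compatible).le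
  · intro U hU
    obtain ⟨O, hO, h⟩ := hu.exists_mem_nhds_one hU
    exact mem_of_superset (mem_sphereWeakUniformity_of_mem_nhds_one hH hO) h

variable (𝕜 H) in
theorem totallyBounded_sphereWeakUniformity :
    IsTotallyBoundedUniformity (sphereWeakUniformity 𝕜 H) :=
  totallyBounded_weakUniformity (c := fun _ => 1) fun _ x => (norm_eq_of_mem_sphere x).le

theorem ellisUniformity_eq_iInf {G X : Type*} [SMul G X] (u : UniformSpace X) :
    ellisUniformity G u = ⨅ x : X, UniformSpace.comap (fun g : G => g • x) u := by
  rw [ellisUniformity, Pi.uniformSpace_eq, UniformSpace.comap_iInf]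
  simp only [← UniformSpace.comap_comap]
  rfl

variable (𝕜 H) in
theorem ellisUniformity_sphere_eq :
    ellisUniformity (UnitaryGroup 𝕜 H) (sphereWeakUniformity 𝕜 H) =
      operatorWeakUniformity 𝕜 H := by
  rw [ellisUniformity_eq_iInf, operatorWeakUniformity, weakUniformity_eq_iInf]
  refine iInf_congr fun x => ?_
  rw [sphereWeakUniformity, comap_weakUniformity, weakUniformity_eq_iInf, iInf_unique]
  rfl

end Sphere

/-! ### The extended action on the completed sphere -/

section Extension

variable {𝕜 H : Type*} [RCLike 𝕜] [NormedAddCommGroup H] [InnerProductSpace 𝕜 H]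

/-- The Fréchet–Riesz theorem for antilinear functionals. -/
theorem exists_eq_inner_right [CompleteSpace H] {φ : H → 𝕜} {C : ℝ}
    (hadd : ∀ v w, φ (v + w) = φ v + φ w)
    (hsmul : ∀ (c : 𝕜) v, φ (c • v) = starRingEnd 𝕜 c * φ v) (hC : ∀ v, ‖φ v‖ ≤ C * ‖v‖) :
    ∃ ξ : H, ∀ v, φ v = ⟪v, ξ⟫_𝕜 := by
  let l : StrongDual 𝕜 H := LinearMap.mkContinuous
    { toFun := fun v => starRingEnd 𝕜 (φ v)
      map_add' := fun v w => by rw [hadd, map_add]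
      map_smul' := fun c v => by
        rw [hsmul, map_mul, RCLike.conj_conj, RingHom.id_apply, smul_eq_mul] } C
    fun v => by simpa using hC v
  refine ⟨(InnerProductSpace.toDual 𝕜 H).symm l, fun v => ?_⟩
  rw [← inner_conj_symm, InnerProductSpace.toDual_symm_apply]
  exact (RCLike.conj_conj _).symm

variable {X : Type*} [u : UniformSpace X] {f : X → H}

/-- Points of the weak completion of a bounded set are represented by vectors. -/
theorem exists_extension_eq_inner [CompleteSpace H] (hf : ∀ x, ‖f x‖ ≤ 1)
    (hu : UniformContinuous fun x (v : H) => ⟪v, f x⟫_𝕜) (y : Completion X) :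
    ∃ ξ : H, ∀ v, Completion.extension (fun x (v : H) => ⟪v, f x⟫_𝕜) y v = ⟪v, ξ⟫_𝕜 := by
  set Φ := Completion.extension fun x (v : H) => ⟪v, f x⟫_𝕜
  have hΦ : ∀ v, Continuous fun y => Φ y v := fun v =>
    (continuous_apply v).comp Completion.continuous_extension
  have hcoe : ∀ (x : X) v, Φ (x : Completion X) v = ⟪v, f x⟫_𝕜 := fun x v =>
    congrFun (Completion.extension_coe hu x) v
  refine exists_eq_inner_right (C := 1) (fun v w => ?_) (fun c v => ?_) fun v => ?_
  · refine Completion.induction_on y (isClosed_eq (hΦ _) ((hΦ _).add (hΦ _))) fun x => ?_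
    simp only [hcoe, inner_add_left]
  · refine Completion.induction_on y (isClosed_eq (hΦ _) (continuous_const.mul (hΦ _))) fun x => ?_
    simp only [hcoe, inner_smul_left]
  · refine Completion.induction_on y (isClosed_le (hΦ _).norm continuous_const) fun x => ?_
    rw [hcoe, mul_comm]
    exact (norm_inner_le_norm _ _).trans (mul_le_mul_of_nonneg_left (hf x) (norm_nonneg _))

/-- A map `T` with adjoint `A` still has the adjoint `A` after extension to the weak completion. -/
theorem extension_map_eq (hu : UniformContinuous fun x (v : H) => ⟪v, f x⟫_𝕜) {T : X → X}
    (hT : UniformContinuous T) {A : H → H} (hA : ∀ x v, ⟪v, f (T x)⟫_𝕜 = ⟪A v, f x⟫_𝕜)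
    (y : Completion X) (v : H) :
    Completion.extension (fun x (v : H) => ⟪v, f x⟫_𝕜) (Completion.map T y) v =
      Completion.extension (fun x (v : H) => ⟪v, f x⟫_𝕜) y (A v) := by
  refine Completion.induction_on y (isClosed_eq ?_ ?_) fun x => ?_
  · exact (continuous_apply v).comp (Completion.continuous_extension.comp Completion.continuous_map)
  · exact (continuous_apply (A v)).comp Completion.continuous_extension
  · rw [Completion.map_coe hT, Completion.extension_coe hu, Completion.extension_coe hu]
    exact hA x v

/-- The points of the weak completion are vectors `ξ`, so that the maps `g ↦ g ξ` on the unitary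
group are controlled by the matrix coefficients. -/
theorem operatorWeakUniformity_le_extendedEllisUniformity [CompleteSpace H]
    [MulAction (UnitaryGroup 𝕜 H) X] (hf : ∀ x, ‖f x‖ ≤ 1)
    (hu : IsUniformInducing fun x (v : H) => ⟪v, f x⟫_𝕜)
    (hG : ∀ (g : UnitaryGroup 𝕜 H) x, f (g • x) = g (f x))
    (hg : ∀ g : UnitaryGroup 𝕜 H, UniformContinuous fun x : X => g • x) :
    operatorWeakUniformity 𝕜 H ≤ extendedEllisUniformity (UnitaryGroup 𝕜 H) u := by
  rw [← uniformContinuous_iff_le_comap]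
  refine (@uniformContinuous_pi _ _ _ _ (operatorWeakUniformity 𝕜 H) _).2 fun y => ?_
  refine (@IsUniformInducing.uniformContinuous_iff _ _ _ (operatorWeakUniformity 𝕜 H) _ _ _ _
    (Completion.isUniformInducing_extension hu)).2 ?_
  refine (@uniformContinuous_pi _ _ _ _ (operatorWeakUniformity 𝕜 H) _).2 fun v => ?_
  obtain ⟨ξ, hξ⟩ := exists_extension_eq_inner hf hu.uniformContinuous y
  convert uniformContinuous_operatorWeakUniformity v ξ using 2 with g
  rw [Function.comp_apply, extension_map_eq hu.uniformContinuous (hg g) (A := ⇑(g⁻¹))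
    (fun x v => by rw [hG, inner_unitary_apply]), hξ, inner_unitary_apply]

/-- The points of `X` are among the points of its completion. -/
theorem extendedEllisUniformity_le_ellisUniformity {G : Type*} [SMul G X]
    (hg : ∀ g : G, UniformContinuous fun x : X => g • x) :
    extendedEllisUniformity G u ≤ ellisUniformity G u := by
  rw [ellisUniformity_eq_iInf]
  refine le_iInf fun x => ?_
  rw [← uniformContinuous_iff_le_comap]
  refine (@IsUniformInducing.uniformContinuous_iff _ _ _
    (extendedEllisUniformity G u) _ _ _ _ (Completion.isUniformInducing_coe X)).2 ?_
  have h1 : UniformContinuous[extendedEllisUniformity G u, _]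
      fun (g : G) (y : Completion X) => Completion.map (fun x : X => g • x) y :=
    uniformContinuous_comap
  convert (@uniformContinuous_pi _ _ _ _ (extendedEllisUniformity G u) _).1 h1
    (x : Completion X) using 2 with g
  exact (Completion.map_coe (hg g) x).symm

variable (𝕜 H) in
theorem extendedEllisUniformity_sphere_eq [CompleteSpace H] :
    extendedEllisUniformity (UnitaryGroup 𝕜 H) (sphereWeakUniformity 𝕜 H) =
      operatorWeakUniformity 𝕜 H := by
  have hg := (isEquiuniformity_sphereWeakUniformity 𝕜 H).saturated
  refine le_antisymm ?_ ?_
  · rw [← ellisUniformity_sphere_eq]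
    exact @extendedEllisUniformity_le_ellisUniformity _ (sphereWeakUniformity 𝕜 H) _ _ hg
  · refine @operatorWeakUniformity_le_extendedEllisUniformity 𝕜 H _ _ _ _
      (sphereWeakUniformity 𝕜 H) (fun x => (x : H)) _ _ (fun x => (norm_eq_of_mem_sphere x).le) ?_
      (fun _ _ => rfl) hg
    refine (@isUniformInducing_iff_uniformSpace _ _ (sphereWeakUniformity 𝕜 H) _ _).2 ?_
    rw [sphereWeakUniformity, weakUniformity_eq_iInf, iInf_unique, Pi.uniformSpace_eq,
      UniformSpace.comap_iInf]
    simp only [← UniformSpace.comap_comap]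
    rfl

end Extension

/-! ### The semigroup of contractions in the weak operator topology -/

section Contractions

variable {𝕜 H : Type*} [RCLike 𝕜] [NormedAddCommGroup H] [InnerProductSpace 𝕜 H]

theorem norm_contraction_apply_le (T : contractions 𝕜 H) (x : H) :
    ‖(T : H →WOT[𝕜] H) x‖ ≤ ‖x‖ :=
  ((T : H →WOT[𝕜] H).toCLM.le_of_opNorm_le T.2 x).trans_eq (one_mul _)

/-- The semigroup of contractions is compact, by Tychonoff's theorem applied to the matrix
coefficients and the representation of bounded sesquilinear forms by operators. -/
instance compactSpace_contractions [CompleteSpace H] : CompactSpace (contractions 𝕜 H) := by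
  refine ⟨isCompact_iff_ultrafilter_le_nhds.2 fun l _ => ?_⟩
  have hB : ∀ x v : H, ∃ z : 𝕜, ‖z‖ ≤ ‖x‖ * ‖v‖ ∧
      Tendsto (fun T : contractions 𝕜 H => ⟪v, (T : H →WOT[𝕜] H) x⟫_𝕜) l (𝓝 z) := by
    intro x v
    obtain ⟨z, hz, hlz⟩ := isCompact_iff_ultrafilter_le_nhds.1
      (isCompact_closedBall (0 : 𝕜) (‖x‖ * ‖v‖))
      (l.map fun T : contractions 𝕜 H => ⟪v, (T : H →WOT[𝕜] H) x⟫_𝕜) (by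
        refine le_principal_iff.2 (Filter.mem_map.2 (univ_mem' fun T => ?_))
        refine mem_closedBall_zero_iff.2 ((norm_inner_le_norm _ _).trans ?_)
        rw [mul_comm]
        exact mul_le_mul_of_nonneg_right (norm_contraction_apply_le T x) (norm_nonneg _))
    exact ⟨z, mem_closedBall_zero_iff.1 hz, hlz⟩
  -- `B x v` is the limit of the matrix coefficients `⟪v, T x⟫` along the ultrafilter
  choose B hBle hB using hB
  have hξ : ∀ x, ∃ ξ : H, ∀ v, B x v = ⟪v, ξ⟫_𝕜 := fun x => by
    refine exists_eq_inner_right (C := ‖x‖) (fun v w => ?_) (fun c v => ?_) (hBle x)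
    · refine tendsto_nhds_unique (hB x (v + w)) ?_
      simpa only [inner_add_left] using (hB x v).add (hB x w)
    · refine tendsto_nhds_unique (hB x (c • v)) ?_
      simpa only [inner_smul_left] using (hB x v).const_mul _
  choose ξ hξ using hξ
  let T : H →ₗ[𝕜] H :=
    { toFun := ξ
      map_add' := fun x y => ext_inner_left 𝕜 fun v => by
        rw [inner_add_right, ← hξ, ← hξ, ← hξ]
        refine tendsto_nhds_unique (hB (x + y) v) ?_
        simpa only [map_add, inner_add_right] using (hB x v).add (hB y v)
      map_smul' := fun c x => ext_inner_left 𝕜 fun v => by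
        rw [RingHom.id_apply, inner_smul_right, ← hξ, ← hξ]
        refine tendsto_nhds_unique (hB (c • x) v) ?_
        simpa only [map_smul, inner_smul_right] using (hB x v).const_mul c }
  have hTle : ∀ x, ‖T x‖ ≤ 1 * ‖x‖ := fun x => by
    change ‖ξ x‖ ≤ _
    rw [one_mul]
    have h := hBle x (ξ x)
    rw [hξ, inner_self_eq_norm_sq_to_K, norm_pow, RCLike.norm_ofReal, abs_norm, sq] at h
    rcases (norm_nonneg (ξ x)).eq_or_lt with h0 | h0
    · exact h0.symm.le.trans (norm_nonneg x)
    · exact le_of_mul_le_mul_right h h0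
  have hT : (.ofCLM (T.mkContinuous 1 hTle) : H →WOT[𝕜] H) ∈ contractions 𝕜 H :=
    T.mkContinuous_norm_le zero_le_one hTle
  refine ⟨⟨_, hT⟩, mem_univ _, ?_⟩
  refine (tendsto_subtype_rng (f := id)).2
    (ContinuousLinearMapWOT.tendsto_iff_forall_inner_apply_tendsto.2 ?_)
  intro x v
  have e : ⟪v, (ContinuousLinearMapWOT.ofCLM (T.mkContinuous 1 hTle) : H →WOT[𝕜] H) x⟫_𝕜 = B x v :=
    (hξ x v).symm
  rw [e]
  exact hB x v

variable (𝕜 H) in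
/-- The unitary group inside the semigroup of contractions. -/
def unitaryToContractions : UnitaryGroup 𝕜 H →* contractions 𝕜 H where
  toFun g := ⟨.ofCLM (g : H →L[𝕜] H), g.toLinearIsometry.norm_toContinuousLinearMap_le⟩
  map_one' := rfl
  map_mul' _ _ := rfl

theorem unitaryToContractions_apply (g : UnitaryGroup 𝕜 H) (x : H) :
    (unitaryToContractions 𝕜 H g : H →WOT[𝕜] H) x = g x := rfl

variable (𝕜 H) in
theorem comap_unitaryToContractions [CompleteSpace H] :
    UniformSpace.comap (unitaryToContractions 𝕜 H) inferInstance = operatorWeakUniformity 𝕜 H := by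
  refine le_antisymm ?_ ?_
  · rw [le_weakUniformity_iff]
    intro x v
    have h1 : UniformContinuous fun T : contractions 𝕜 H =>
        ContinuousLinearMapWOT.inducingFn (RingHom.id 𝕜) H H (T : H →WOT[𝕜] H) :=
      (uniformContinuous_comap (f := ContinuousLinearMapWOT.inducingFn (RingHom.id 𝕜) H H)).comp
        uniformContinuous_subtype_val
    have h2 := uniformContinuous_pi.1 h1 ((x : H), InnerProductSpace.toDual 𝕜 H v)
    exact @UniformContinuous.comp _ _ _
      (UniformSpace.comap (unitaryToContractions 𝕜 H) inferInstance) _ _ _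
      (unitaryToContractions 𝕜 H) h2 uniformContinuous_comap
  · rw [← uniformContinuous_iff_le_comap]
    refine @uniformContinuous_comap' _ _ _ _ _ _ (operatorWeakUniformity 𝕜 H) ?_
    refine @uniformContinuous_comap' _ _ _ _ _ _ (operatorWeakUniformity 𝕜 H) ?_
    refine (@uniformContinuous_pi _ _ _ _ (operatorWeakUniformity 𝕜 H) _).2 fun p => ?_
    convert uniformContinuous_operatorWeakUniformity
      ((InnerProductSpace.toDual 𝕜 H).symm p.2) p.1 using 2 with g
    rw [InnerProductSpace.toDual_symm_apply]
    rfl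

variable (𝕜 H) in
theorem toTopologicalSpace_operatorWeakUniformity :
    (operatorWeakUniformity 𝕜 H).toTopologicalSpace = unitaryTopology 𝕜 H :=
  toTopologicalSpace_weakUniformity isInducing_unitary (c := fun _ => 1) norm_unitary_sphere

variable (𝕜 H) in
/-- On the unitary group the weak and the strong operator topologies coincide. -/
theorem isEmbedding_unitaryToContractions [CompleteSpace H] :
    IsEmbedding (unitaryToContractions 𝕜 H) where
  eq_induced := by
    rw [← toTopologicalSpace_operatorWeakUniformity, ← comap_unitaryToContractions]
    rfl
  injective g h e := LinearIsometryEquiv.ext fun x => by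
    rw [← unitaryToContractions_apply, e, unitaryToContractions_apply]

/-- Multiplication is jointly continuous when the left factor is unitary, because `g⁻¹ v` depends
on `g` continuously in norm. -/
theorem continuous_unitary_mul [CompleteSpace H] :
    Continuous fun p : UnitaryGroup 𝕜 H × contractions 𝕜 H =>
      unitaryToContractions 𝕜 H p.1 * p.2 := by
  refine Continuous.subtype_mk (ContinuousLinearMapWOT.continuous_iff.2 fun x v => ?_) _
  refine continuous_iff_continuousAt.2 fun q => tendsto_iff_norm_sub_tendsto_zero.2 ?_
  have e : ∀ p : UnitaryGroup 𝕜 H × contractions 𝕜 H,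
      ⟪v, ((unitaryToContractions 𝕜 H p.1 : H →WOT[𝕜] H) * (p.2 : H →WOT[𝕜] H)) x⟫_𝕜 =
        ⟪p.1⁻¹ v, (p.2 : H →WOT[𝕜] H) x⟫_𝕜 := fun p => inner_unitary_apply _ _ _
  have h1 : Tendsto (fun p : UnitaryGroup 𝕜 H × contractions 𝕜 H => p.1⁻¹ v) (𝓝 q)
      (𝓝 (q.1⁻¹ v)) :=
    unitary_tendsto_iff.1 ((continuous_inv.comp continuous_fst).tendsto q) v
  have h2 : Tendsto (fun p : UnitaryGroup 𝕜 H × contractions 𝕜 H =>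
      ⟪q.1⁻¹ v, (p.2 : H →WOT[𝕜] H) x⟫_𝕜) (𝓝 q) (𝓝 ⟪q.1⁻¹ v, (q.2 : H →WOT[𝕜] H) x⟫_𝕜) :=
    ((ContinuousLinearMapWOT.continuous_iff.1 continuous_subtype_val x (q.1⁻¹ v)).comp
      continuous_snd).tendsto q
  have h3 := (((tendsto_iff_norm_sub_tendsto_zero.1 h1).mul_const ‖x‖).add
    (tendsto_iff_norm_sub_tendsto_zero.1 h2))
  rw [zero_mul, zero_add] at h3
  -- `⟪p⁻¹ v, T x⟫ - ⟪q⁻¹ v, S x⟫ = ⟪p⁻¹ v - q⁻¹ v, T x⟫ + ⟪q⁻¹ v, (T - S) x⟫`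
  refine squeeze_zero (fun _ => norm_nonneg _) (fun p => ?_) h3
  change ‖⟪v, ((unitaryToContractions 𝕜 H p.1 : H →WOT[𝕜] H) * (p.2 : H →WOT[𝕜] H)) x⟫_𝕜 -
    ⟪v, ((unitaryToContractions 𝕜 H q.1 : H →WOT[𝕜] H) * (q.2 : H →WOT[𝕜] H)) x⟫_𝕜‖ ≤ _
  rw [e, e, ← sub_add_sub_cancel _ ⟪q.1⁻¹ v, (p.2 : H →WOT[𝕜] H) x⟫_𝕜, ← inner_sub_left]
  refine (norm_add_le _ _).trans (add_le_add_left ((norm_inner_le_norm _ _).trans ?_) _)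
  exact mul_le_mul_of_nonneg_left (norm_contraction_apply_le p.2 x) (norm_nonneg _)

/-- In an infinite-dimensional Hilbert space the unitaries are weakly dense among the
contractions. -/
theorem denseRange_unitaryToContractions [CompleteSpace H] (hH : ¬ FiniteDimensional 𝕜 H) :
    DenseRange (unitaryToContractions 𝕜 H) := by
  classical
  intro T
  have : ∀ s : Finset H, ∃ h : UnitaryGroup 𝕜 H, ∀ x ∈ s, ∀ y ∈ s,
      ⟪y, h x⟫_𝕜 = ⟪y, (T : H →WOT[𝕜] H) x⟫_𝕜 := fun s => by
    have : FiniteDimensional 𝕜 (Submodule.span 𝕜 (s : Set H)) :=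
      FiniteDimensional.span_of_finite 𝕜 s.finite_toSet
    obtain ⟨h, hh⟩ := exists_unitary_dilation hH (Submodule.span 𝕜 (s : Set H)) _ T.2
    exact ⟨h, fun x hx y hy => hh x (Submodule.subset_span hx) y (Submodule.subset_span hy)⟩
  choose h hh using this
  -- the net of the unitaries that agree with `T` on a finite set converges to `T`
  have hlim : Tendsto (fun s => unitaryToContractions 𝕜 H (h s)) atTop (𝓝 T) := by
    refine tendsto_subtype_rng.2
      (ContinuousLinearMapWOT.tendsto_iff_forall_inner_apply_tendsto.2 fun x y => ?_)
    refine tendsto_const_nhds.congr' ?_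
    filter_upwards [eventually_ge_atTop ({x, y} : Finset H)] with s hs
    exact (hh s x (hs (by simp)) y (hs (by simp))).symm
  exact mem_closure_of_tendsto hlim (Eventually.of_forall fun s => mem_range_self _)

end Contractions

/-! ### Completions inside the semigroup of contractions -/

section Completions

/-- The completion of a uniform space that sits in a complete space is its closure there. -/
theorem exists_homeomorph_closure_range {X C : Type*} (u : UniformSpace X) [UniformSpace C]
    [CompleteSpace C] [T0Space C] {j : X → C} (hj : @IsUniformInducing _ _ u _ j) :
    ∃ φ : CompletionOf u ≃ₜ closure (range j), ∀ x, (φ (toCompletionOf u x) : C) = j x := by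
  have hind := Completion.isUniformInducing_extension hj
  have hcoe : ∀ x : X, Completion.extension j x = j x := Completion.extension_coe
    hj.uniformContinuous
  have hrange : range (Completion.extension j) = closure (range j) := by
    refine Subset.antisymm ?_ ?_
    · refine (Completion.continuous_extension.range_subset_closure_image_dense
        Completion.denseRange_coe).trans (closure_mono ?_)
      rintro _ ⟨_, ⟨x, rfl⟩, rfl⟩
      exact ⟨x, (hcoe x).symm⟩
    · refine closure_minimal ?_ hind.isComplete_range.isClosed
      rintro _ ⟨x, rfl⟩
      exact ⟨x, hcoe x⟩
  exact ⟨hind.isInducing.isEmbedding.toHomeomorph.trans (Homeomorph.setCongr hrange), hcoe⟩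

/-- Proper Ellis semigroup compactifications are transported by topological isomorphisms. -/
theorem IsProperEllisCompactification.of_homeomorph {G S K : Type*} [Group G] [TopologicalSpace G]
    [Semigroup S] [TopologicalSpace S] [Semigroup K] [TopologicalSpace K] {s : G → S} {k : G → K}
    (hk : IsProperEllisCompactification G K k) (φ : S ≃ₜ K) (hφ : ∀ x y, φ (x * y) = φ x * φ y)
    (hs : ∀ g, φ (s g) = k g) : IsProperEllisCompactification G S s := by
  have hmul : ∀ x y, x * y = φ.symm (φ x * φ y) := fun x y => by
    rw [← hφ, φ.symm_apply_apply]
  have hsk : s = φ.symm ∘ k := funext fun g => by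
    rw [Function.comp_apply, ← hs, φ.symm_apply_apply]
  have := hk.compact
  have := hk.hausdorff
  refine ⟨φ.symm.compactSpace, φ.symm.t2Space, fun y => ?_, fun g h => φ.injective ?_, ?_, ?_, ?_⟩
  · simp only [hmul]
    exact φ.symm.continuous.comp ((hk.right_topological (φ y)).comp φ.continuous)
  · rw [hφ, hs, hs, hs, hk.map_mul]
  · rw [hsk]
    exact φ.symm.isEmbedding.comp hk.embedding
  · rw [hsk]
    exact φ.symm.surjective.denseRange.comp hk.dense φ.symm.continuous
  · simp only [hmul]
    have hr : ∀ x : range s, φ x ∈ range k := by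
      rintro ⟨_, g, rfl⟩
      exact ⟨g, (hs g).symm⟩
    have h1 : Continuous fun p : range s × S => ((⟨φ p.1, hr p.1⟩ : range k), φ p.2) :=
      ((φ.continuous.comp (continuous_subtype_val.comp continuous_fst)).subtype_mk _).prodMk
        (φ.continuous.comp continuous_snd)
    exact φ.symm.continuous.comp (hk.continuous_mul.comp h1)

variable (𝕜 H : Type*) [RCLike 𝕜] [NormedAddCommGroup H] [InnerProductSpace 𝕜 H] [CompleteSpace H]

/-- The closure of the unitary group in the semigroup of contractions. -/
def unitaryClosure : Submonoid (contractions 𝕜 H) :=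
  (MonoidHom.mrange (unitaryToContractions 𝕜 H)).topologicalClosure

/-- The unitary group inside its weak closure. -/
def unitaryToClosure (g : UnitaryGroup 𝕜 H) : unitaryClosure 𝕜 H :=
  ⟨unitaryToContractions 𝕜 H g, subset_closure (mem_range_self g)⟩

theorem isEmbedding_unitaryToClosure : IsEmbedding (unitaryToClosure 𝕜 H) :=
  IsEmbedding.of_comp
    ((isEmbedding_unitaryToContractions 𝕜 H).continuous.subtype_mk _) continuous_subtype_val
    (isEmbedding_unitaryToContractions 𝕜 H)

theorem isProperEllisCompactification_unitaryClosure :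
    IsProperEllisCompactification (UnitaryGroup 𝕜 H) (unitaryClosure 𝕜 H)
      (unitaryToClosure 𝕜 H) where
  compact := isCompact_iff_compactSpace.1
    (isClosed_closure (s := range (unitaryToContractions 𝕜 H))).isCompact
  hausdorff := inferInstance
  right_topological y := continuous_mul_const y
  map_mul _ _ := rfl
  embedding := isEmbedding_unitaryToClosure 𝕜 H
  dense := by
    intro x
    rw [closure_subtype, ← range_comp]
    exact x.2
  continuous_mul := by
    let i := (isEmbedding_unitaryToClosure 𝕜 H).toHomeomorph
    refine continuous_induced_rng.2 ((continuous_unitary_mul.comp ((i.symm.continuous.comp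
      continuous_fst).prodMk (continuous_subtype_val.comp continuous_snd))).congr fun p => ?_)
    have h : unitaryToClosure 𝕜 H (i.symm p.1) = p.1 :=
      congrArg Subtype.val (i.apply_symm_apply p.1)
    exact congrArg (fun T : unitaryClosure 𝕜 H => (T : contractions 𝕜 H) * p.2) h

theorem isUniformInducing_unitaryToContractions :
    @IsUniformInducing _ _ (operatorWeakUniformity 𝕜 H) _ (unitaryToContractions 𝕜 H) :=
  (@isUniformInducing_iff_uniformSpace _ _ (operatorWeakUniformity 𝕜 H) _ _).2
    (comap_unitaryToContractions 𝕜 H)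

/-- The completion of the unitary group for the matrix coefficient uniformity is its weak closure
in the semigroup of contractions, and carries the multiplication of operators. -/
theorem exists_semigroup_completion (u : UniformSpace (UnitaryGroup 𝕜 H))
    (hu : u = operatorWeakUniformity 𝕜 H) :
    ∃ _ : Semigroup (CompletionOf u),
      IsProperEllisCompactification (UnitaryGroup 𝕜 H) (CompletionOf u) (toCompletionOf u) ∧
      SeparatelyContinuousMul (CompletionOf u) ∧
      (¬ FiniteDimensional 𝕜 H →
        ∃ φ : CompletionOf u ≃* contractions 𝕜 H, IsHomeomorph φ ∧
          ∀ (g : UnitaryGroup 𝕜 H) (x : H),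
            (φ (toCompletionOf u g) : H →WOT[𝕜] H) x = g x) := by
  subst hu
  obtain ⟨φ, hφ⟩ : ∃ φ : CompletionOf (operatorWeakUniformity 𝕜 H) ≃ₜ unitaryClosure 𝕜 H,
      ∀ g, (φ (toCompletionOf _ g) : contractions 𝕜 H) = unitaryToContractions 𝕜 H g :=
    exists_homeomorph_closure_range _ (isUniformInducing_unitaryToContractions 𝕜 H)
  let _ : Semigroup (CompletionOf (operatorWeakUniformity 𝕜 H)) := φ.toEquiv.semigroup
  have hmul : ∀ x y, φ (x * y) = φ x * φ y := fun x y => φ.apply_symm_apply _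
  refine ⟨inferInstance, (isProperEllisCompactification_unitaryClosure 𝕜 H).of_homeomorph φ hmul
    fun g => Subtype.ext (hφ g), IsInducing.separatelyContinuousMul
      (⟨φ, hmul⟩ : CompletionOf (operatorWeakUniformity 𝕜 H) →ₙ* unitaryClosure 𝕜 H) φ.isInducing,
    fun hH => ?_⟩
  -- in infinite dimension the closure consists of all contractions
  have htop : unitaryClosure 𝕜 H = ⊤ :=
    SetLike.coe_injective (denseRange_unitaryToContractions hH).closure_range
  have hval : IsHomeomorph (Subtype.val : unitaryClosure 𝕜 H → contractions 𝕜 H) := by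
    refine isHomeomorph_iff_continuous_isClosedMap_bijective.2 ⟨continuous_subtype_val,
      (isClosed_closure (s := range (unitaryToContractions 𝕜 H))).isClosedMap_subtype_val,
      Subtype.val_injective, fun T => ⟨⟨T, htop ▸ Submonoid.mem_top T⟩, rfl⟩⟩
  have hψ : IsHomeomorph fun x => (φ x : contractions 𝕜 H) := hval.comp φ.isHomeomorph
  refine ⟨⟨Equiv.ofBijective _ hψ.bijective, fun x y => ?_⟩, hψ, fun g x => ?_⟩
  · exact congrArg Subtype.val (hmul x y)
  · exact congrArg (fun T : contractions 𝕜 H => (T : H →WOT[𝕜] H) x) (hφ g)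

/-- The matrix coefficient uniformity is an equiuniformity for left translations. -/
theorem isEllisEquiuniformity_operatorWeakUniformity :
    IsEllisEquiuniformity (UnitaryGroup 𝕜 H) (operatorWeakUniformity 𝕜 H) where
  equiuniformity := isEquiuniformity_weakUniformity isInducing_unitary (c := fun _ => 1)
    norm_unitary_sphere fun _ _ _ => rfl
  totallyBounded := totallyBounded_weakUniformity (c := fun _ => 1)
    fun x g => (norm_unitary_sphere x g).le
  ellis := by
    obtain ⟨s, hs, -⟩ := exists_semigroup_completion 𝕜 H _ rfl
    exact ⟨s, hs⟩

end Completions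

theorem mainTheorem2 (𝕜 H : Type*) [RCLike 𝕜] [NormedAddCommGroup H] [InnerProductSpace 𝕜 H]
    [CompleteSpace H] :
    -- the maximal equiuniformity on the sphere exists and is totally bounded
    (IsEquiuniformity (UnitaryGroup 𝕜 H) (maxEquiuniformity (UnitaryGroup 𝕜 H) (UnitSphere H)) ∧
      IsTotallyBoundedUniformity (maxEquiuniformity (UnitaryGroup 𝕜 H) (UnitSphere H))) ∧
    -- the five uniformities on the unitary group coincide
    (extendedEllisUniformity (UnitaryGroup 𝕜 H)
          (maxEquiuniformity (UnitaryGroup 𝕜 H) (UnitSphere H)) =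
        ellisUniformity (UnitaryGroup 𝕜 H)
          (maxEquiuniformity (UnitaryGroup 𝕜 H) (UnitSphere H)) ∧
      ellisUniformity (UnitaryGroup 𝕜 H)
          (maxEquiuniformity (UnitaryGroup 𝕜 H) (UnitSphere H)) =
        roelckeUniformity (UnitaryGroup 𝕜 H) ∧
      roelckeUniformity (UnitaryGroup 𝕜 H) =
        stabilizerUniformity (UnitaryGroup 𝕜 H) (UnitSphere H) ∧
      stabilizerUniformity (UnitaryGroup 𝕜 H) (UnitSphere H) =
        stabilizerUniformity (UnitaryGroup 𝕜 H) (UnitBall H)) ∧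
    IsRoelckePrecompact (UnitaryGroup 𝕜 H) ∧
    IsEllisEquiuniformity (UnitaryGroup 𝕜 H) (roelckeUniformity (UnitaryGroup 𝕜 H)) ∧
    -- the Ellis semigroup structure of the Roelcke compactification
    ∃ _ : Semigroup (RoelckeCompletion (UnitaryGroup 𝕜 H)),
      IsProperEllisCompactification (UnitaryGroup 𝕜 H) (RoelckeCompletion (UnitaryGroup 𝕜 H))
        (toRoelckeCompletion (UnitaryGroup 𝕜 H)) ∧
      SeparatelyContinuousMul (RoelckeCompletion (UnitaryGroup 𝕜 H)) ∧
      (¬ FiniteDimensional 𝕜 H →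
        ∃ φ : RoelckeCompletion (UnitaryGroup 𝕜 H) ≃* contractions 𝕜 H,
          IsHomeomorph φ ∧
          ∀ (g : UnitaryGroup 𝕜 H) (x : H),
            (φ (toRoelckeCompletion (UnitaryGroup 𝕜 H) g) : H →WOT[𝕜] H) x = g x) := by
  have hR := roelckeUniformity_eq_operatorWeakUniformity 𝕜 H
  have hE := ellisUniformity_sphere_eq 𝕜 H
  have hW := isEllisEquiuniformity_operatorWeakUniformity 𝕜 H
  rw [maxEquiuniformity_sphere_eq]
  refine ⟨⟨isEquiuniformity_sphereWeakUniformity 𝕜 H, totallyBounded_sphereWeakUniformity 𝕜 H⟩,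
    ⟨(extendedEllisUniformity_sphere_eq 𝕜 H).trans hE.symm, hE.trans hR.symm,
      hR.trans (stabilizerUniformity_sphere_eq_operatorWeakUniformity 𝕜 H).symm,
      (stabilizerUniformity_sphere_eq_operatorWeakUniformity 𝕜 H).trans
        (stabilizerUniformity_ball_eq_operatorWeakUniformity 𝕜 H).symm⟩, ?_, ?_,
    exists_semigroup_completion 𝕜 H _ hR⟩
  · rw [IsRoelckePrecompact, hR]
    exact hW.totallyBounded
  · rw [hR]
    exact hW
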